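/- Let $X$ be a countable set, let $b:X\times X\to[0,\infty)$ be symmetric with $b(x,x)=0$ and $n(x):=\sum_{y\in X}b(x,y)\in(0,\infty)$ for all $x\in X$, and suppose that the graph with edges $x\sim y:\Leftrightarrow b(x,y)>0$ is connected; fix $x_0\in X$. Regard $n$ as a measure, $n(A)=\sum_{x\in A}n(x)$, and let $\ell^2(X,n)$ be the Hilbert space of real-valued $n$-square-summable functions with norm $\|\cdot\|$. Put $\widetilde{\mathcal E}(u)=\frac12\sum_{x,y}b(x,y)(u(x)-u(y))^2$. Let $\mathcal E$ be the restriction of $\widetilde{\mathcal E}$ to the closure of the finitely supported functions in $\{u\in\ell^2(X,n):\widetilde{\mathcal E}(u)<\infty\}$ with respect to $(\widetilde{\mathcal E}(u)+\|u\|^2)^{1/2}$, and let $L$ (the normalized Laplacian) be the positive self-adjoint operator on $\ell^2(X,n)$ arising from $\mathcal E$. Write $\lambda_0(L)=\inf\sigma(L)$ and $\lambda_0^{\mathrm{ess}}(L)=\inf\sigma_{\mathrm{ess}}(L)$ (with $\inf\emptyset=\infty$), where $\sigma_{\mathrm{ess}}(L)$ is $\sigma(L)$ without the isolated eigenvalues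 of finite multiplicity. Let $d(x,y)$ be the least number of edges of a path from $x$ to $y$, $B_r(x)=\{y: d(x,y)\le r\}$, and $$\mu=\liminf_{r\to\infty}\frac1r\log n(B_r(x_0)),\qquad \widetilde\mu=\liminf_{r\to\infty}\frac1r\inf_{x\in X}\log\frac{n(B_r(x))}{n(B_1(x))},$$ where $\infty/\infty$ is read as $\infty$; both lie in $[0,\infty]$. For $t\in[0,\infty)$ let $F(t)=1-\dfrac{2e^{t/2}}{1+e^{t}}$, and $F(\infty)=1$. Then $\lambda_0(L)\le F(\mu)$ and $\lambda_0(L)\le F(\widetilde\mu)$. If moreover $n(X)=\infty$, then $\lambda_0^{\mathrm{ess}}(L)\le F(\widetilde\mu)$ and $\lambda_0^{\mathrm{ess}}(L)\le F(\mu)$. -/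

import Mathlib

open Set Filter Topology MeasureTheory
open scoped ENNReal

/-! ### Spectrum of an unbounded operator -/

noncomputable section

namespace UnboundedOperator

variable {H : Type*} [NormedAddCommGroup H] [NormedSpace ℝ H]

/-- `c` is in the resolvent set of the (unbounded) operator `T` if `T - c`, as a map from the
domain of `T` to `H`, has a bounded everywhere defined inverse. -/
def IsResolventPoint (T : H →ₗ.[ℝ] H) (c : ℝ) : Prop :=
  ∃ R : H →L[ℝ] H,
    (∀ u : T.domain, R (T u - c • (u : H)) = u) ∧
    (∀ v : H, ∃ h : R v ∈ T.domain, T ⟨R v, h⟩ - c • R v = v)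

/-- The (real) spectrum of `T`. For a self-adjoint operator on a real Hilbert space this is the
spectrum of its complexification. -/
def spectrum (T : H →ₗ.[ℝ] H) : Set ℝ := {c | ¬ IsResolventPoint T c}

/-- The eigenspace `{u ∈ D(T) | T u = c u}`. -/
def eigenspace (T : H →ₗ.[ℝ] H) (c : ℝ) : Submodule ℝ T.domain :=
  LinearMap.ker (T.toFun - c • T.domain.subtype)

/-- The discrete spectrum: isolated points of the spectrum that are eigenvalues of finite
multiplicity. -/
def discreteSpectrum (T : H →ₗ.[ℝ] H) : Set ℝ :=
  {c | c ∈ spectrum T ∧ (∃ ε > 0, ∀ c' ∈ spectrum T, |c' - c| < ε → c' = c) ∧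
    eigenspace T c ≠ ⊥ ∧ FiniteDimensional ℝ (eigenspace T c)}

/-- The essential spectrum: the complement of the discrete spectrum in the spectrum. -/
def essentialSpectrum (T : H →ₗ.[ℝ] H) : Set ℝ := spectrum T \ discreteSpectrum T

/-- The bottom of the spectrum, as an extended real number (`inf ∅ = ∞`). -/
def bottom (T : H →ₗ.[ℝ] H) : EReal := ⨅ c ∈ spectrum T, (c : EReal)

/-- The bottom of the essential spectrum, as an extended real number (`inf ∅ = ∞`). -/
def essentialBottom (T : H →ₗ.[ℝ] H) : EReal := ⨅ c ∈ essentialSpectrum T, (c : EReal)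

end UnboundedOperator

/-! ### Exponential volume growth -/

namespace VolumeGrowth

variable {X : Type*} [MeasurableSpace X]

/-- The closed distance ball `{x | ρ x x₀ ≤ r}`. -/
def ball (ρ : X → X → ℝ) (x₀ : X) (r : ℝ) : Set X := {x | ρ x x₀ ≤ r}

/-- The exponential volume growth `liminf_{r → ∞} (1/r) log ν(B_r(x₀))`. -/
def expGrowth (ν : Measure X) (ρ : X → X → ℝ) (x₀ : X) : EReal :=
  liminf (fun r : ℝ => ((1 / r : ℝ) : EReal) * ENNReal.log (ν (ball ρ x₀ r))) atTop

/-- The minimal exponential volume growth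
`liminf_{r → ∞} (1/r) inf_x log (ν(B_r(x)) / ν(B_1(x)))`.
Centres `x` with `ν(B_1(x)) = ∞` do not contribute to the infimum, i.e. the quotient `∞/∞` is read
as `∞` (in `ℝ≥0∞` the junk value would be `0`). -/
def minExpGrowth (ν : Measure X) (ρ : X → X → ℝ) : EReal :=
  liminf (fun r : ℝ => ((1 / r : ℝ) : EReal) *
    ⨅ (x : X) (_ : ν (ball ρ x 1) ≠ ∞),
      ENNReal.log (ν (ball ρ x r) / ν (ball ρ x 1))) atTop

/-- The function `t ↦ 1 - 2 e^{t/2} / (1 + e^t)` for `t ∈ [0, ∞]`, with its limit `1` at `t = ∞`. -/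
def fujiwaraBound (t : EReal) : ℝ :=
  if t = ⊤ then 1 else 1 - 2 * Real.exp (t.toReal / 2) / (1 + Real.exp t.toReal)

end VolumeGrowth

/-! ### Weighted graphs and their Laplacians -/

/-- A weighted graph `b` over `(X, m)`: a symmetric map `b : X × X → [0, ∞)` with vanishing diagonal
and summable rows, and a measure of full support given by `m : X → (0, ∞)`. -/
structure WeightedGraph (X : Type*) where
  /-- the edge weights -/
  b : X → X → ℝ
  /-- the vertex weights -/
  m : X → ℝ
  b_nonneg : ∀ x y, 0 ≤ b x y
  b_symm : ∀ x y, b x y = b y x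
  b_diag : ∀ x, b x x = 0
  b_summable : ∀ x, Summable (b x)
  m_pos : ∀ x, 0 < m x

namespace WeightedGraph

variable {X : Type*} (G : WeightedGraph X)

/-- The underlying combinatorial graph: `x ∼ y` iff `b x y > 0`. -/
def graph : SimpleGraph X where
  Adj x y := 0 < G.b x y
  symm := ⟨fun x y h => by rw [G.b_symm y x]; exact h⟩
  loopless := ⟨fun x h => by rw [G.b_diag x] at h; exact lt_irrefl _ h⟩

/-- The natural graph metric: the least number of edges of a path connecting two vertices. -/
def natDist (x y : X) : ℝ := (G.graph.dist x y : ℝ)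

/-- `Ẽ(u) = (1/2) ∑_{x,y} b(x,y) (u(x) - u(y))² ∈ [0, ∞]`. -/
def energy (u : X → ℝ) : ℝ≥0∞ :=
  2⁻¹ * ∑' x, ∑' y, ENNReal.ofReal (G.b x y * (u x - u y) ^ 2)

/-- The bilinear form `(1/2) ∑_{x,y} b(x,y) (u(x) - u(y)) (v(x) - v(y))`; the sum converges
absolutely if `u` and `v` have finite energy. -/
def energyForm (u v : X → ℝ) : ℝ :=
  1 / 2 * ∑' p : X × X, G.b p.1 p.2 * (u p.1 - u p.2) * (v p.1 - v p.2)

theorem energy_add_le (u v : X → ℝ) :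
    G.energy (u + v) ≤ 2 * G.energy u + 2 * G.energy v := by
  have h : ∑' x, ∑' y, ENNReal.ofReal (G.b x y * ((u + v) x - (u + v) y) ^ 2) ≤
      2 * ∑' x, ∑' y, ENNReal.ofReal (G.b x y * (u x - u y) ^ 2) +
      2 * ∑' x, ∑' y, ENNReal.ofReal (G.b x y * (v x - v y) ^ 2) := by
    simp only [← ENNReal.tsum_mul_left, ← ENNReal.tsum_add]
    refine ENNReal.tsum_le_tsum fun x => ENNReal.tsum_le_tsum fun y => ?_
    have hb := G.b_nonneg x y
    have e2 : (2 : ℝ≥0∞) = ENNReal.ofReal 2 := by simp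
    rw [e2, ← ENNReal.ofReal_mul (by norm_num), ← ENNReal.ofReal_mul (by norm_num),
      ← ENNReal.ofReal_add (by positivity) (by positivity)]
    refine ENNReal.ofReal_le_ofReal ?_
    simp only [Pi.add_apply]
    nlinarith [mul_nonneg hb (sq_nonneg ((u x - u y) - (v x - v y)))]
  calc G.energy (u + v) ≤ 2⁻¹ * (2 * ∑' x, ∑' y, ENNReal.ofReal (G.b x y * (u x - u y) ^ 2) +
      2 * ∑' x, ∑' y, ENNReal.ofReal (G.b x y * (v x - v y) ^ 2)) := by
        unfold energy; gcongr
    _ = 2 * G.energy u + 2 * G.energy v := by unfold energy; ring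

theorem energy_smul (c : ℝ) (u : X → ℝ) :
    G.energy (c • u) = ENNReal.ofReal (c ^ 2) * G.energy u := by
  have h : ∀ x y, ENNReal.ofReal (G.b x y * ((c • u) x - (c • u) y) ^ 2) =
      ENNReal.ofReal (c ^ 2) * ENNReal.ofReal (G.b x y * (u x - u y) ^ 2) := by
    intro x y
    rw [← ENNReal.ofReal_mul (sq_nonneg c)]
    congr 1
    simp only [Pi.smul_apply, smul_eq_mul]
    ring
  unfold energy
  simp only [h, ENNReal.tsum_mul_left]
  ring

theorem energy_zero : G.energy 0 = 0 := by simp [energy]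

theorem summable_sq_of_energy {u : X → ℝ} (hu : G.energy u < ∞) :
    Summable fun p : X × X => G.b p.1 p.2 * (u p.1 - u p.2) ^ 2 := by
  have h : ∑' p : X × X, ENNReal.ofReal (G.b p.1 p.2 * (u p.1 - u p.2) ^ 2) ≠ ∞ := by
    rw [ENNReal.tsum_prod' (f := fun p : X × X =>
      ENNReal.ofReal (G.b p.1 p.2 * (u p.1 - u p.2) ^ 2))]
    intro htop
    unfold energy at hu
    rw [htop, ENNReal.mul_top (by simp)] at hu
    exact lt_irrefl _ hu
  refine (ENNReal.summable_toReal h).congr fun p => ?_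
  rw [ENNReal.toReal_ofReal (mul_nonneg (G.b_nonneg _ _) (sq_nonneg _))]

theorem summable_energyForm {u v : X → ℝ} (hu : G.energy u < ∞) (hv : G.energy v < ∞) :
    Summable fun p : X × X => G.b p.1 p.2 * (u p.1 - u p.2) * (v p.1 - v p.2) := by
  refine Summable.of_norm_bounded
    ((G.summable_sq_of_energy hu).add (G.summable_sq_of_energy hv)) fun p => ?_
  have hb := G.b_nonneg p.1 p.2
  rw [Real.norm_eq_abs, abs_le]
  constructor <;>
  nlinarith [mul_nonneg hb (sq_nonneg ((u p.1 - u p.2) - (v p.1 - v p.2))),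
    mul_nonneg hb (sq_nonneg ((u p.1 - u p.2) + (v p.1 - v p.2))),
    mul_nonneg hb (sq_nonneg (u p.1 - u p.2)), mul_nonneg hb (sq_nonneg (v p.1 - v p.2))]

theorem energyForm_add_left {u v w : X → ℝ} (hu : G.energy u < ∞) (hv : G.energy v < ∞)
    (hw : G.energy w < ∞) :
    G.energyForm (u + v) w = G.energyForm u w + G.energyForm v w := by
  unfold energyForm
  rw [← mul_add, ← (G.summable_energyForm hu hw).tsum_add (G.summable_energyForm hv hw)]
  congr 1
  refine tsum_congr fun p => ?_
  simp only [Pi.add_apply]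
  ring

theorem energyForm_smul_left (c : ℝ) (u w : X → ℝ) :
    G.energyForm (c • u) w = c * G.energyForm u w := by
  have h : ∀ p : X × X, G.b p.1 p.2 * ((c • u) p.1 - (c • u) p.2) * (w p.1 - w p.2) =
      c * (G.b p.1 p.2 * (u p.1 - u p.2) * (w p.1 - w p.2)) := fun p => by
    simp only [Pi.smul_apply, smul_eq_mul]
    ring
  unfold energyForm
  simp only [h, tsum_mul_left]
  ring

theorem energyForm_zero_left (w : X → ℝ) : G.energyForm 0 w = 0 := by simp [energyForm]

theorem energy_lt_top_of_support_singleton {u : X → ℝ} {x : X} (hu : ∀ y, y ≠ x → u y = 0) :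
    G.energy u < ∞ := by
  classical
  have hrow : ∑' y, ENNReal.ofReal (G.b x y) < ∞ := by
    rw [← ENNReal.ofReal_tsum_of_nonneg (G.b_nonneg x) (G.b_summable x)]
    exact ENNReal.ofReal_lt_top
  have hle : ∀ z y, ENNReal.ofReal (G.b z y * (u z - u y) ^ 2) ≤
      (if z = x then ENNReal.ofReal (u x ^ 2) * ENNReal.ofReal (G.b x y) else 0) +
      (if y = x then ENNReal.ofReal (u x ^ 2) * ENNReal.ofReal (G.b x z) else 0) := by
    intro z y
    by_cases hz : z = x
    · subst hz
      by_cases hy : y = z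
      · subst hy; simp
      · simp only [if_true, hy, if_false, add_zero, hu y hy, sub_zero]
        rw [← ENNReal.ofReal_mul (sq_nonneg _), mul_comm]
    · by_cases hy : y = x
      · subst hy
        simp only [if_true, hz, if_false, zero_add, hu z hz, zero_sub, even_two, Even.neg_pow]
        rw [← ENNReal.ofReal_mul (sq_nonneg _), mul_comm, G.b_symm z y]
      · simp [hu z hz, hu y hy]
  unfold energy
  refine ENNReal.mul_lt_top (by simp) ?_
  refine (ENNReal.tsum_le_tsum fun z => ENNReal.tsum_le_tsum fun y => hle z y).trans_lt ?_
  simp only [ENNReal.tsum_add]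
  refine ENNReal.add_lt_top.mpr ⟨?_, ?_⟩
  · rw [tsum_eq_single x (fun z hz => by simp [hz])]
    simp only [if_true, ENNReal.tsum_mul_left]
    exact ENNReal.mul_lt_top (by simp) hrow
  · have : ∀ z, ∑' y, (if y = x then ENNReal.ofReal (u x ^ 2) * ENNReal.ofReal (G.b x z) else 0) =
        ENNReal.ofReal (u x ^ 2) * ENNReal.ofReal (G.b x z) := fun z => by
      rw [tsum_eq_single x (fun y hy => by simp [hy])]; simp
    simp only [this, ENNReal.tsum_mul_left]
    exact ENNReal.mul_lt_top (by simp) hrow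

variable [MeasurableSpace X]

/-- The measure on `X` with point masses `m x`. -/
def measure : Measure X := Measure.sum fun x => ENNReal.ofReal (G.m x) • Measure.dirac x

variable [DiscreteMeasurableSpace X]

theorem measure_singleton (x : X) : G.measure {x} = ENNReal.ofReal (G.m x) := by
  rw [measure, Measure.sum_apply _ (MeasurableSet.of_discrete)]
  rw [tsum_eq_single x]
  · simp
  · intro y hy
    simp [hy]

theorem eq_of_ae_eq {u v : X → ℝ} (h : u =ᵐ[G.measure] v) : u = v := by
  funext x
  by_contra hx
  have h0 : G.measure {x} ≤ 0 := by
    rw [← (ae_iff.mp h : G.measure {a | ¬ u a = v a} = 0)]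
    exact measure_mono (by simpa using hx)
  rw [G.measure_singleton] at h0
  exact absurd h0 (not_le.mpr (ENNReal.ofReal_pos.mpr (G.m_pos x)))

/-- The Hilbert space `ℓ²(X, m)` of real-valued functions. -/
abbrev L2 : Type _ := Lp ℝ 2 G.measure

theorem coe_add (u v : G.L2) : (⇑(u + v) : X → ℝ) = ⇑u + ⇑v := G.eq_of_ae_eq (Lp.coeFn_add u v)

theorem coe_sub (u v : G.L2) : (⇑(u - v) : X → ℝ) = ⇑u - ⇑v := G.eq_of_ae_eq (Lp.coeFn_sub u v)

theorem coe_smul (c : ℝ) (u : G.L2) : (⇑(c • u) : X → ℝ) = c • ⇑u :=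
  G.eq_of_ae_eq (Lp.coeFn_smul c u)

theorem coe_zero : ((0 : G.L2) : X → ℝ) = 0 :=
  G.eq_of_ae_eq (Lp.coeFn_zero (E := ℝ) (p := 2) (μ := G.measure))

/-- The square `‖u‖² + Ẽ(u)` of the form norm. -/
def formNormSq (u : G.L2) : ℝ≥0∞ := ENNReal.ofReal (‖u‖ ^ 2) + G.energy u

theorem formNormSq_add_le (u v : G.L2) :
    G.formNormSq (u + v) ≤ 2 * G.formNormSq u + 2 * G.formNormSq v := by
  unfold formNormSq
  have h1 : ENNReal.ofReal (‖u + v‖ ^ 2) ≤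
      2 * ENNReal.ofReal (‖u‖ ^ 2) + 2 * ENNReal.ofReal (‖v‖ ^ 2) := by
    have e2 : (2 : ℝ≥0∞) = ENNReal.ofReal 2 := by simp
    generalize hA : ‖u + v‖ = A
    generalize hB : ‖u‖ = B
    generalize hC : ‖v‖ = C
    rw [e2, ← ENNReal.ofReal_mul (by norm_num), ← ENNReal.ofReal_mul (by norm_num),
      ← ENNReal.ofReal_add (by positivity) (by positivity)]
    subst hA hB hC
    refine ENNReal.ofReal_le_ofReal ?_
    nlinarith [norm_add_le u v, norm_nonneg (u + v), sq_nonneg (‖u‖ - ‖v‖)]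
  have h2 := G.energy_add_le u v
  rw [coe_add]
  calc _ ≤ (2 * ENNReal.ofReal (‖u‖ ^ 2) + 2 * ENNReal.ofReal (‖v‖ ^ 2)) +
        (2 * G.energy u + 2 * G.energy v) := add_le_add h1 h2
    _ = _ := by ring

theorem formNormSq_smul (c : ℝ) (u : G.L2) :
    G.formNormSq (c • u) = ENNReal.ofReal (c ^ 2) * G.formNormSq u := by
  unfold formNormSq
  rw [coe_smul, energy_smul, norm_smul, mul_pow, ENNReal.ofReal_mul (by positivity),
    Real.norm_eq_abs, sq_abs, mul_add]

theorem formNormSq_zero : G.formNormSq 0 = 0 := by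
  rw [formNormSq, coe_zero, energy_zero, norm_zero]
  simp

/-- The domain of the regular Dirichlet form of the graph: the closure with respect to the form
norm, inside `{u ∈ ℓ²(X, m) | Ẽ(u) < ∞}`, of the finitely supported functions. -/
def formDomain : Submodule ℝ G.L2 where
  carrier := {u | G.energy u < ∞ ∧
    ∀ ε : ℝ≥0∞, 0 < ε → ∃ φ : G.L2, (Function.support (φ : X → ℝ)).Finite ∧
      G.formNormSq (u - φ) < ε}
  add_mem' := by
    rintro u v ⟨hu, hu'⟩ ⟨hv, hv'⟩
    refine ⟨?_, fun ε hε => ?_⟩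
    · rw [coe_add]
      refine (G.energy_add_le u v).trans_lt ?_
      exact ENNReal.add_lt_top.mpr ⟨ENNReal.mul_lt_top (by simp) hu, ENNReal.mul_lt_top (by simp) hv⟩
    · have hε' : 0 < ε / 4 := ENNReal.div_pos hε.ne' (by simp)
      obtain ⟨φ, hφ, h1⟩ := hu' (ε / 4) hε'
      obtain ⟨ψ, hψ, h2⟩ := hv' (ε / 4) hε'
      refine ⟨φ + ψ, ?_, ?_⟩
      · rw [coe_add]
        exact (hφ.union hψ).subset (Function.support_add _ _)
      · have : u + v - (φ + ψ) = (u - φ) + (v - ψ) := by abel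
        rw [this]
        refine (G.formNormSq_add_le _ _).trans_lt ?_
        have hs : 2 * (ε / 4) + 2 * (ε / 4) = ε := by
          rw [← mul_add, ← two_mul, ← mul_assoc, mul_comm, ENNReal.div_mul]
          all_goals norm_num
          rw [ENNReal.div_self] <;> norm_num
        calc _ < 2 * (ε / 4) + 2 * (ε / 4) :=
              ENNReal.add_lt_add (ENNReal.mul_lt_mul_right (by simp) (by simp) h1)
                (ENNReal.mul_lt_mul_right (by simp) (by simp) h2)
          _ = ε := hs
  zero_mem' := by
    refine ⟨by rw [coe_zero, energy_zero]; simp, fun ε hε => ⟨0, ?_, ?_⟩⟩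
    · rw [coe_zero]; simp
    · rw [sub_zero, formNormSq_zero]; exact hε
  smul_mem' := by
    rintro c u ⟨hu, hu'⟩
    refine ⟨?_, fun ε hε => ?_⟩
    · rw [coe_smul, energy_smul]
      exact ENNReal.mul_lt_top (by simp) hu
    · obtain ⟨φ, hφ, h1⟩ := hu' (ε / (ENNReal.ofReal (c ^ 2) + 1))
        (ENNReal.div_pos hε.ne' (by simp))
      refine ⟨c • φ, ?_, ?_⟩
      · rw [coe_smul]
        exact hφ.subset (Function.support_const_smul_subset c _)
      · rw [← smul_sub, formNormSq_smul]
        have h2 : G.formNormSq (u - φ) * (ENNReal.ofReal (c ^ 2) + 1) < ε :=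
          (ENNReal.lt_div_iff_mul_lt (by simp) (by simp)).mp h1
        refine lt_of_le_of_lt ?_ h2
        rw [mul_comm]
        gcongr
        exact le_self_add

/-- The graph of the operator arising from the form: all `(u, v)` such that `u` is in the form
domain and `E(u, φ) = ⟨v, φ⟩` for all `φ` in the form domain. -/
def laplacianGraph : Submodule ℝ (G.L2 × G.L2) where
  carrier := {p | p.1 ∈ G.formDomain ∧
    ∀ φ ∈ G.formDomain, G.energyForm p.1 φ = inner ℝ p.2 φ}
  add_mem' := by
    rintro ⟨u, v⟩ ⟨u', v'⟩ ⟨hu, huv⟩ ⟨hu', huv'⟩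
    refine ⟨G.formDomain.add_mem hu hu', fun φ hφ => ?_⟩
    simp only [Prod.mk_add_mk] at *
    rw [coe_add, G.energyForm_add_left hu.1 hu'.1 hφ.1, inner_add_left, huv φ hφ, huv' φ hφ]
  zero_mem' := by
    refine ⟨G.formDomain.zero_mem, fun φ _ => ?_⟩
    change G.energyForm (((0 : G.L2) : X → ℝ)) φ = inner ℝ (0 : G.L2) φ
    rw [coe_zero, energyForm_zero_left, inner_zero_left]
  smul_mem' := by
    rintro c ⟨u, v⟩ ⟨hu, huv⟩
    refine ⟨G.formDomain.smul_mem c hu, fun φ hφ => ?_⟩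
    simp only [Prod.smul_mk] at *
    rw [coe_smul, energyForm_smul_left, huv φ hφ, real_inner_smul_left]

/-- The positive self-adjoint operator `L` on `ℓ²(X, m)` arising from the regular Dirichlet form. -/
def laplacian : G.L2 →ₗ.[ℝ] G.L2 := G.laplacianGraph.toLinearPMap

/-- The graph of `laplacian` is single-valued, so `laplacian` is the operator with exactly this
graph. -/
theorem laplacian_graph : G.laplacian.graph = G.laplacianGraph := by
  refine Submodule.toLinearPMap_graph_eq _ ?_
  rintro ⟨u, v⟩ ⟨-, huv⟩ (rfl : u = 0)
  change v = 0
  refine Lp.ext ?_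
  rw [coe_zero]
  refine Filter.Eventually.of_forall fun x => ?_
  have hfin : G.measure {x} ≠ ∞ := by rw [measure_singleton]; exact ENNReal.ofReal_ne_top
  let δ : G.L2 := indicatorConstLp 2 (MeasurableSet.of_discrete (s := {x})) hfin (1 : ℝ)
  have hδ : (⇑δ : X → ℝ) = ({x} : Set X).indicator fun _ => (1 : ℝ) :=
    G.eq_of_ae_eq indicatorConstLp_coeFn
  have hδ0 : ∀ y, y ≠ x → δ y = 0 := fun y hy => by rw [hδ]; simp [hy]
  have hmem : δ ∈ G.formDomain := by
    refine ⟨G.energy_lt_top_of_support_singleton hδ0, fun ε hε => ⟨δ, ?_, ?_⟩⟩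
    · refine (Set.finite_singleton x).subset fun y hy => ?_
      by_contra h
      exact hy (hδ0 y h)
    · rw [sub_self, formNormSq_zero]; exact hε
  have h := huv δ hmem
  have h0 : G.energyForm (((0 : G.L2) : X → ℝ)) δ = 0 := by
    rw [coe_zero, energyForm_zero_left]
  simp only at h
  rw [h0, real_inner_comm, L2.inner_indicatorConstLp_one, integral_singleton, measureReal_def,
    measure_singleton, ENNReal.toReal_ofReal (G.m_pos x).le, smul_eq_mul] at h
  have := G.m_pos x
  simpa [this.ne'] using h.symm

end WeightedGraph

end

/-! For the normalizing measure the energy is at most `2‖u‖²`, so the form is defined on all of `ℓ²`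
and `L` is a bounded symmetric operator `T` with `⟨T u, u⟩ = E(u)`. Upper bounds for the two
spectral bottoms then come from test functions: Rayleigh quotients near `c` give `λ₀ ≤ c`, and if
moreover their normalized mass tends to zero on every finite set, they are weakly null and give
`λ₀ᵉˢˢ ≤ c`. Both principles are proved by continuation instead of the spectral theorem: a lower
bound of the form can be raised as long as it meets no spectrum, and, modulo a finite dimensional
subspace, as long as it meets no essential spectrum (`form_ge_of_isUnit`,
`exists_finiteDimensional_form_ge`).

The test function is `1` on a ball of radius `s` about `x`, decays like `exp (-α (d - s))` outside
it and is cut off at radius `r`. Adjacent values inside the large ball differ by a factor of at most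
`e^α`, and for two such numbers `(p - q)² ≤ F(2α) (p² + q²)`. Summing over edges gives `F(2α) ‖f‖²`,
plus an error from the edges leaving the large ball of at most `exp (-2α (r - 1 - s)) n(B_r)`. If
`n(B_r) ≤ e^{γ r} n(B_1)` for arbitrarily large `r`, possibly with changing centres, and `γ < 2α`,
the error is negligible relative to `‖f‖² ≥ n(B_1)`. Both growth rates supply such balls, and `2α`
then decreases to the growth rate. An infinite rate needs only the value `1`, attained by point
functions.

For the essential spectrum there is a dichotomy. If all balls about one centre satisfy `n(B_r) ≤ C
e^{2α r}`, a fixed centre with large plateau radius works, since infinite total volume makes the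
mass at each given vertex relatively small. Otherwise every vertex `y` has a ball `B_t(y)` with
volume exceeding any prescribed multiple of `e^{2α t}`. A test function varies by at most `e^{α t}`
on that ball, so little of its mass can sit at `y`, wherever its centre is. -/

namespace SymmetricOperator

/-! ### Lower bounds of bounded symmetric operators by continuation through the resolvent set. -/

variable {H : Type*} [NormedAddCommGroup H] [InnerProductSpace ℝ H]

/-- Obtained by testing nonnegativity at `u - ‖S‖⁻¹ S u`. Only nonnegativity on `W` is needed, which
is what permits its use modulo a finite dimensional space. -/
theorem sq_norm_apply_le {S : H →L[ℝ] H} (hS : ∀ u v, inner ℝ (S u) v = inner ℝ u (S v))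
    (W : Submodule ℝ H) (hW : ∀ v ∈ W, 0 ≤ inner ℝ (S v) v) {u : H} (hu : u ∈ W)
    (hSu : S u ∈ W) : ‖S u‖ ^ 2 ≤ ‖S‖ * inner ℝ (S u) u := by
  rcases (norm_nonneg S).eq_or_lt with h0 | h0
  · have : S = 0 := norm_eq_zero.mp h0.symm
    simp [this]
  · have h1 := hW (u - (‖S‖⁻¹) • S u) (W.sub_mem hu (W.smul_mem _ hSu))
    have h2 : inner ℝ (S (S u)) (S u) ≤ ‖S‖ * ‖S u‖ ^ 2 := by
      calc _ ≤ ‖S (S u)‖ * ‖S u‖ := real_inner_le_norm _ _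
        _ ≤ (‖S‖ * ‖S u‖) * ‖S u‖ := by gcongr; exact S.le_opNorm _
        _ = _ := by ring
    simp only [map_sub, map_smul, inner_sub_left, inner_sub_right, real_inner_smul_left,
      real_inner_smul_right, hS (S u) u, real_inner_self_eq_norm_sq] at h1
    have h3 : ‖S‖⁻¹ * (‖S‖⁻¹ * inner ℝ (S (S u)) (S u)) ≤ ‖S‖⁻¹ * ‖S u‖ ^ 2 := by
      calc _ ≤ ‖S‖⁻¹ * (‖S‖⁻¹ * (‖S‖ * ‖S u‖ ^ 2)) := by gcongr
        _ = _ := by field_simp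
    have h4 : ‖S‖⁻¹ * ‖S u‖ ^ 2 ≤ inner ℝ (S u) u := by linarith
    calc ‖S u‖ ^ 2 = ‖S‖ * (‖S‖⁻¹ * ‖S u‖ ^ 2) := by field_simp
      _ ≤ _ := by gcongr

theorem exists_le_norm_apply_of_isUnit {S : H →L[ℝ] H} (hS : IsUnit S) :
    ∃ c > 0, ∀ u, c * ‖u‖ ≤ ‖S u‖ := by
  obtain ⟨R, -, hR⟩ := isUnit_iff_exists.mp hS
  refine ⟨(‖R‖ + 1)⁻¹, by positivity, fun u => ?_⟩
  rw [inv_mul_le_iff₀ (by positivity)]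
  have : R (S u) = u := by simpa using congrArg (fun A : H →L[ℝ] H => A u) hR
  calc ‖u‖ = ‖R (S u)‖ := by rw [this]
    _ ≤ ‖R‖ * ‖S u‖ := R.le_opNorm _
    _ ≤ (‖R‖ + 1) * ‖S u‖ := by gcongr; linarith

theorem symm_sub_smul {S : H →L[ℝ] H} (hS : ∀ u v, inner ℝ (S u) v = inner ℝ u (S v)) (c : ℝ)
    (u v : H) : inner ℝ ((S - c • (1 : H →L[ℝ] H)) u) v =
      inner ℝ u ((S - c • (1 : H →L[ℝ] H)) v) := by
  simp [inner_sub_left, inner_sub_right, real_inner_smul_left, real_inner_smul_right, hS]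

theorem inner_sub_smul (S : H →L[ℝ] H) (c : ℝ) (u : H) :
    inner ℝ ((S - c • (1 : H →L[ℝ] H)) u) u = inner ℝ (S u) u - c * ‖u‖ ^ 2 := by
  simp [inner_sub_left, real_inner_smul_left]

/-- A lower bound for a symmetric form improves as long as it stays in the resolvent set. -/
theorem form_ge_of_isUnit {Q : H →L[ℝ] H} (hQ : ∀ u v, inner ℝ (Q u) v = inner ℝ u (Q v))
    {a b : ℝ} (hab : a ≤ b) (ha : ∀ u, a * ‖u‖ ^ 2 ≤ inner ℝ (Q u) u)
    (hunit : ∀ c, a ≤ c → c < b → IsUnit (Q - c • (1 : H →L[ℝ] H))) (u : H) :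
    b * ‖u‖ ^ 2 ≤ inner ℝ (Q u) u := by
  set A : Set ℝ := {c | c ≤ b ∧ ∀ u, c * ‖u‖ ^ 2 ≤ inner ℝ (Q u) u} with hA
  have hne : A.Nonempty := ⟨a, hab, ha⟩
  have hbdd : BddAbove A := ⟨b, fun c hc => hc.1⟩
  have hclosed : IsClosed A := by
    have : A = Iic b ∩ ⋂ u, {c : ℝ | c * ‖u‖ ^ 2 ≤ inner ℝ (Q u) u} := by
      ext c; simp [hA]
    rw [this]
    exact isClosed_Iic.inter (isClosed_iInter fun u => isClosed_le (by fun_prop) (by fun_prop))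
  have hm := hclosed.csSup_mem hne hbdd
  set m := sSup A
  rcases hm.1.eq_or_lt with h | h
  · rw [← h]; exact hm.2 u
  · exfalso
    obtain ⟨c, hc, hc'⟩ := exists_le_norm_apply_of_isUnit
      (hunit m (le_csSup hbdd ⟨hab, ha⟩) h)
    set S := Q - m • (1 : H →L[ℝ] H)
    -- A nonnegative operator that is bounded below in norm is bounded below as a form, so `m` could
    -- be raised. The `+ 1` covers `‖S‖ = 0`.
    have key : ∀ u, c ^ 2 / (‖S‖ + 1) * ‖u‖ ^ 2 ≤ inner ℝ (S u) u := by
      intro u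
      have h0 : ∀ v, 0 ≤ inner ℝ (S v) v := fun v => by
        rw [inner_sub_smul]; linarith [hm.2 v]
      have h1 := sq_norm_apply_le (symm_sub_smul hQ m) ⊤ (fun v _ => h0 v)
        (u := u) trivial trivial
      have h2 : c ^ 2 * ‖u‖ ^ 2 ≤ ‖S u‖ ^ 2 := by
        rw [← mul_pow]; exact pow_le_pow_left₀ (by positivity) (hc' u) 2
      rw [div_mul_eq_mul_div, div_le_iff₀ (by positivity)]
      nlinarith [h0 u]
    have hmem : min b (m + c ^ 2 / (‖S‖ + 1)) ∈ A := by
      refine ⟨min_le_left _ _, fun u => ?_⟩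
      have := key u
      rw [inner_sub_smul] at this
      calc _ ≤ (m + c ^ 2 / (‖S‖ + 1)) * ‖u‖ ^ 2 := by gcongr; exact min_le_right _ _
        _ ≤ _ := by linarith
    have hle := le_csSup hbdd hmem
    have : m < min b (m + c ^ 2 / (‖S‖ + 1)) :=
      lt_min h (by have : 0 < c ^ 2 / (‖S‖ + 1) := by positivity
                   linarith)
    exact absurd hle (not_le.mpr this)

/-- If `0` is at most an isolated spectral point of a symmetric operator, then the operator is
bounded below on the orthogonal complement of its kernel. -/
theorem le_norm_apply_of_isolated [CompleteSpace H] {S : H →L[ℝ] H}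
    (hS : ∀ u v, inner ℝ (S u) v = inner ℝ u (S v)) {ε : ℝ} (hε : 0 < ε)
    (hunit : ∀ t : ℝ, t ≠ 0 → |t| < ε → IsUnit (S - t • (1 : H →L[ℝ] H))) {w : H}
    (hw : w ∈ (LinearMap.ker (S : H →ₗ[ℝ] H))ᗮ) : ε * ‖w‖ ≤ ‖S w‖ := by
  -- The polynomial `t⁴ - ε² t²` is negative only for `0 < |t| < ε`, where `S` has no spectrum, and
  -- its minimum is `-ε⁴/4`. Hence `Q` should be nonnegative, which says that `S` is bounded below
  -- by `ε` on its range.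
  set Q : H →L[ℝ] H := S * S * (S * S) - ε ^ 2 • (S * S) with hQdef
  have hQ : ∀ u v, inner ℝ (Q u) v = inner ℝ u (Q v) := fun u v => by
    simp [hQdef, inner_sub_left, inner_sub_right, real_inner_smul_left, real_inner_smul_right, hS]
  have hQform : ∀ u, inner ℝ (Q u) u = ‖S (S u)‖ ^ 2 - ε ^ 2 * ‖S u‖ ^ 2 := fun u => by
    simp [hQdef, inner_sub_left, real_inner_smul_left, hS]
  have hlow : ∀ u, -(ε ^ 4 / 4) * ‖u‖ ^ 2 ≤ inner ℝ (Q u) u := fun u => by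
    have h : ‖S (S u) - (ε ^ 2 / 2) • u‖ ^ 2 =
        ‖S (S u)‖ ^ 2 - ε ^ 2 * ‖S u‖ ^ 2 + ε ^ 4 / 4 * ‖u‖ ^ 2 := by
      rw [norm_sub_sq_real, real_inner_smul_right, hS, real_inner_self_eq_norm_sq, norm_smul,
        Real.norm_eq_abs, abs_of_pos (by positivity)]
      ring
    have := sq_nonneg ‖S (S u) - (ε ^ 2 / 2) • u‖
    rw [hQform]; linarith
  have hQunit : ∀ m, -(ε ^ 4 / 4) ≤ m → m < 0 → IsUnit (Q - m • (1 : H →L[ℝ] H)) := by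
    intro m hm1 hm2
    -- The roots of `a² - ε² a = m` are `ε²/2 ± s`, both in `(0, ε²)`. So `Q - m` is a product of
    -- two factors `S² - r²`, each splitting as `(S - r) (S + r)` with `0 < r < ε`.
    set s := √(ε ^ 4 / 4 + m)
    have hs : s ^ 2 = ε ^ 4 / 4 + m := Real.sq_sqrt (by linarith)
    have hs0 : 0 ≤ s := Real.sqrt_nonneg _
    have hs1 : s < ε ^ 2 / 2 := by
      apply lt_of_pow_lt_pow_left₀ 2 (by positivity)
      rw [hs]; nlinarith
    have hP : ∀ a, 0 < a → a < ε ^ 2 → IsUnit (S * S - a • (1 : H →L[ℝ] H)) := by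
      intro a ha0 ha1
      obtain ⟨r, hr0, rfl⟩ : ∃ r, 0 < r ∧ a = r ^ 2 :=
        ⟨√a, Real.sqrt_pos.mpr ha0, (Real.sq_sqrt ha0.le).symm⟩
      have hr1 : r < ε := lt_of_pow_lt_pow_left₀ 2 hε.le ha1
      have h := (hunit r hr0.ne' (by rwa [abs_of_pos hr0])).mul
        (hunit (-r) (by linarith) (by rwa [abs_neg, abs_of_pos hr0]))
      convert h using 1
      ext u
      simp
      module
    have h := (hP (ε ^ 2 / 2 + s) (by positivity) (by linarith)).mul
      (hP (ε ^ 2 / 2 - s) (by linarith) (by nlinarith))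
    convert h using 1
    ext u
    simp [hQdef]
    rw [show m = s ^ 2 - ε ^ 4 / 4 by linarith]
    module
  have hpos := form_ge_of_isUnit hQ (by have := pow_pos hε 4; linarith) hlow hQunit
  have hrange : ∀ v, ε * ‖S v‖ ≤ ‖S (S v)‖ := fun v => by
    have := hpos v
    rw [hQform] at this
    refine abs_le_of_sq_le_sq' ?_ (norm_nonneg _) |>.2
    rw [mul_pow]; linarith
  have hsub : (LinearMap.range (S : H →ₗ[ℝ] H))ᗮ ≤ LinearMap.ker (S : H →ₗ[ℝ] H) := by
    intro v hv
    have h := (Submodule.mem_orthogonal _ _).mp hv (S (S v)) ⟨S v, rfl⟩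
    rw [hS, real_inner_self_eq_norm_sq] at h
    simpa using h
  have hw' : w ∈ (LinearMap.range (S : H →ₗ[ℝ] H)).topologicalClosure := by
    rw [← Submodule.orthogonal_orthogonal_eq_closure]
    exact Submodule.orthogonal_le hsub hw
  have hcl : IsClosed {v : H | ε * ‖v‖ ≤ ‖S v‖} := isClosed_le (by fun_prop) (by fun_prop)
  refine hcl.closure_subset_iff.mpr ?_ hw'
  rintro _ ⟨v, rfl⟩
  exact hrange v

/-- Lower bounds of the form off finite dimensional spaces improve as long as they stay away from
the essential spectrum. -/
theorem exists_finiteDimensional_form_ge [CompleteSpace H] {T : H →L[ℝ] H}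
    (hT : ∀ u v, inner ℝ (T u) v = inner ℝ u (T v)) {b : ℝ}
    (hunit : ∀ c < b, FiniteDimensional ℝ (LinearMap.ker ((T - c • (1 : H →L[ℝ] H) : H →L[ℝ] H) : H →ₗ[ℝ] H)) ∧
      ∃ ε > 0, ∀ c', c' ≠ c → |c' - c| < ε → IsUnit (T - c' • (1 : H →L[ℝ] H)))
    {a : ℝ} (hab : a < b) :
    ∃ W : Submodule ℝ H, FiniteDimensional ℝ W ∧ ∀ u ∈ Wᗮ, a * ‖u‖ ^ 2 ≤ inner ℝ (T u) u := by
  set A : Set ℝ := {c | c ≤ b ∧ ∃ W : Submodule ℝ H, FiniteDimensional ℝ W ∧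
    ∀ u ∈ Wᗮ, c * ‖u‖ ^ 2 ≤ inner ℝ (T u) u} with hA
  have hdown : ∀ c ∈ A, ∀ c' ≤ c, c' ∈ A := by
    rintro c ⟨hcb, W, hW, h⟩ c' hc'
    refine ⟨hc'.trans hcb, W, hW, fun u hu => le_trans ?_ (h u hu)⟩
    gcongr
  have hne : A.Nonempty := by
    refine ⟨min b (-‖T‖), min_le_left _ _, ⊥, inferInstance, fun u _ => ?_⟩
    have h1 : |inner ℝ (T u) u| ≤ ‖T‖ * ‖u‖ ^ 2 := by
      calc _ ≤ ‖T u‖ * ‖u‖ := abs_real_inner_le_norm _ _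
        _ ≤ ‖T‖ * ‖u‖ * ‖u‖ := by gcongr; exact T.le_opNorm _
        _ = _ := by ring
    calc _ ≤ -‖T‖ * ‖u‖ ^ 2 := by gcongr; exact min_le_right _ _
      _ ≤ _ := by linarith [(abs_le.mp h1).1]
  have hbdd : BddAbove A := ⟨b, fun c hc => hc.1⟩
  have hmb : sSup A ≤ b := csSup_le hne fun c hc => hc.1
  set m := sSup A with hm
  suffices h : m = b by
    obtain ⟨c, hc, hac⟩ := exists_lt_of_lt_csSup hne (by rw [← hm, h]; exact hab)
    exact (hdown c hc a hac.le).2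
  refine hmb.eq_or_lt.resolve_right fun hlt => ?_
  obtain ⟨hK, ε, hε, hiso⟩ := hunit m hlt
  set S := T - m • (1 : H →L[ℝ] H) with hSdef
  have hS := symm_sub_smul hT m
  have hbelow : ∀ w ∈ (LinearMap.ker (S : H →ₗ[ℝ] H))ᗮ, ε * ‖w‖ ≤ ‖S w‖ := fun w hw =>
    le_norm_apply_of_isolated hS hε (fun t ht htε => by
      have := hiso (m + t) (by simpa using ht) (by simpa using htε)
      convert this using 1
      rw [add_smul]; abel) hw
  -- The supremum need not be attained, because `W` may grow as `c` approaches it. The argument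
  -- therefore starts at `m - δ`, with `δ` smaller than the later gain `(ε / 2)² / (‖S‖ + ε)`.
  obtain ⟨δ, hδ0, hδε, hδ⟩ : ∃ δ > 0, δ ≤ ε / 2 ∧ δ * (‖S‖ + ε) < (ε / 2) ^ 2 := by
    refine ⟨min (ε / 2) ((ε / 2) ^ 2 / (2 * (‖S‖ + ε))), lt_min (by positivity) (by positivity),
      min_le_left _ _, ?_⟩
    have hp : 0 < ‖S‖ + ε := by positivity
    calc _ ≤ (ε / 2) ^ 2 / (2 * (‖S‖ + ε)) * (‖S‖ + ε) := by gcongr; exact min_le_right _ _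
      _ = (ε / 2) ^ 2 / 2 := by field_simp
      _ < _ := by have : 0 < (ε / 2) ^ 2 := by positivity
                  linarith
  have hmem : m - δ ∈ A := by
    obtain ⟨c, hc, hac⟩ := exists_lt_of_lt_csSup hne (show m - δ < m by linarith)
    exact hdown c hc _ hac.le
  obtain ⟨-, W, hW, hWform⟩ := hmem
  set S' := T - (m - δ) • (1 : H →L[ℝ] H) with hS'def
  have hS' := symm_sub_smul hT (m - δ)
  have hSS' : ∀ u, S' u = S u + δ • u := fun u => by
    simp [hS'def, hSdef]; module
  have hnorm : ‖S'‖ ≤ ‖S‖ + ε := by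
    refine ContinuousLinearMap.opNorm_le_bound _ (by positivity) fun u => ?_
    rw [hSS']
    calc _ ≤ ‖S u‖ + ‖δ • u‖ := norm_add_le _ _
      _ ≤ ‖S‖ * ‖u‖ + ε * ‖u‖ := by
        rw [norm_smul, Real.norm_eq_abs, abs_of_pos hδ0]
        gcongr
        · exact S.le_opNorm _
        · linarith
      _ = _ := by ring
  -- Orthogonality to `W` makes the form of `S'` nonnegative at `u`, orthogonality to `S' W` puts
  -- `S' u` into `Wᗮ` by symmetry, and orthogonality to the kernel bounds `‖S u‖` below.
  set V : Submodule ℝ H := W ⊔ W.map (S' : H →ₗ[ℝ] H) ⊔ LinearMap.ker (S : H →ₗ[ℝ] H)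
  have hV : ∀ u ∈ Vᗮ, (ε / 2) ^ 2 * ‖u‖ ^ 2 ≤ (‖S‖ + ε) * inner ℝ (S' u) u := by
    intro u hu
    have hu1 : u ∈ Wᗮ := Submodule.orthogonal_le (le_sup_left.trans le_sup_left) hu
    have hu2 : u ∈ (W.map (S' : H →ₗ[ℝ] H))ᗮ :=
      Submodule.orthogonal_le (le_sup_right.trans le_sup_left) hu
    have hu3 := hbelow u (Submodule.orthogonal_le le_sup_right hu)
    have hnn : ∀ v ∈ Wᗮ, 0 ≤ inner ℝ (S' v) v := fun v hv => by
      rw [inner_sub_smul]; linarith [hWform v hv]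
    have hSu : S' u ∈ Wᗮ := by
      rw [Submodule.mem_orthogonal]
      intro w hw
      rw [← hS']
      exact (Submodule.mem_orthogonal _ _).mp hu2 _ ⟨w, hw, rfl⟩
    have h1 := sq_norm_apply_le hS' Wᗮ hnn hu1 hSu
    have h2 : ε / 2 * ‖u‖ ≤ ‖S' u‖ := by
      have h3 : ‖S u‖ ≤ ‖S' u‖ + δ * ‖u‖ := by
        have : S u = S' u - δ • u := by rw [hSS']; abel
        rw [this]
        refine (norm_sub_le _ _).trans ?_
        rw [norm_smul, Real.norm_eq_abs, abs_of_pos hδ0]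
      nlinarith [norm_nonneg u]
    calc _ = (ε / 2 * ‖u‖) ^ 2 := by ring
      _ ≤ ‖S' u‖ ^ 2 := pow_le_pow_left₀ (by positivity) h2 2
      _ ≤ ‖S'‖ * inner ℝ (S' u) u := h1
      _ ≤ _ := by gcongr; exact hnn u hu1
  have hp : 0 < ‖S‖ + ε := by positivity
  have hgt : 0 < (ε / 2) ^ 2 / (‖S‖ + ε) - δ := by
    rw [sub_pos, lt_div_iff₀ hp]; exact hδ
  have hmem2 : min b (m + ((ε / 2) ^ 2 / (‖S‖ + ε) - δ)) ∈ A := by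
    refine ⟨min_le_left _ _, V, inferInstance, fun u hu => ?_⟩
    have h1 := hV u hu
    rw [inner_sub_smul] at h1
    have h2 : (ε / 2) ^ 2 / (‖S‖ + ε) * ‖u‖ ^ 2 ≤ inner ℝ (T u) u - (m - δ) * ‖u‖ ^ 2 := by
      rw [div_mul_eq_mul_div, div_le_iff₀ hp]; linarith
    calc _ ≤ (m + ((ε / 2) ^ 2 / (‖S‖ + ε) - δ)) * ‖u‖ ^ 2 := by gcongr; exact min_le_right _ _
      _ ≤ _ := by linarith
  have hle := le_csSup hbdd hmem2
  exact absurd hle (not_le.mpr (lt_min hlt (by linarith)))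

/-- Along a weakly null family of unit vectors the form is asymptotically at least any lower bound
off a finite dimensional space. -/
theorem le_of_weakly_null {ι : Type*} {l : Filter ι} [l.NeBot] {T : H →L[ℝ] H}
    (hT : ∀ u v, inner ℝ (T u) v = inner ℝ u (T v)) {W : Submodule ℝ H}
    [FiniteDimensional ℝ W] {a c : ℝ} (hW : ∀ u ∈ Wᗮ, a * ‖u‖ ^ 2 ≤ inner ℝ (T u) u)
    {f : ι → H} (hf : ∀ i, ‖f i‖ = 1) (hweak : ∀ g, Tendsto (fun i => inner ℝ g (f i)) l (𝓝 0))
    (hform : ∀ᶠ i in l, inner ℝ (T (f i)) (f i) ≤ c) : a ≤ c := by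
  -- The projection has finite rank, so weak convergence becomes norm convergence, and removing it
  -- changes norms and form values negligibly.
  have hproj : Tendsto (fun i => W.starProjection (f i)) l (𝓝 0) := by
    have h : ∀ u, W.starProjection u =
        ∑ j, inner ℝ ((stdOrthonormalBasis ℝ W j : W) : H) u • ((stdOrthonormalBasis ℝ W j : W) : H) := by
      intro u
      rw [Submodule.starProjection_apply, ← (stdOrthonormalBasis ℝ W).sum_repr (W.orthogonalProjectionOnto u)]
      simp [OrthonormalBasis.repr_apply_apply]
    simp only [h]
    rw [show (0 : H) = ∑ j, (0 : ℝ) • ((stdOrthonormalBasis ℝ W j : W) : H) by simp]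
    exact tendsto_finsetSum _ fun j _ => (hweak _).smul_const _
  set p := fun i => W.starProjection (f i)
  have hmem : ∀ i, f i - p i ∈ Wᗮ := fun i => W.sub_starProjection_mem_orthogonal (f i)
  have hpn : Tendsto (fun i => ‖p i‖) l (𝓝 0) := by simpa using hproj.norm
  have hbound : ∀ i, a * ‖f i - p i‖ ^ 2 ≤
      inner ℝ (T (f i)) (f i) + (2 * ‖T‖ * ‖p i‖ + ‖T‖ * ‖p i‖ ^ 2) := by
    intro i
    refine (hW _ (hmem i)).trans ?_
    have h1 : -(inner ℝ (T (f i)) (p i)) ≤ ‖T‖ * ‖p i‖ := by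
      calc _ ≤ |inner ℝ (T (f i)) (p i)| := neg_le_abs _
        _ ≤ ‖T (f i)‖ * ‖p i‖ := abs_real_inner_le_norm _ _
        _ ≤ ‖T‖ * ‖f i‖ * ‖p i‖ := by gcongr; exact T.le_opNorm _
        _ = _ := by rw [hf, mul_one]
    have h2 : inner ℝ (T (p i)) (p i) ≤ ‖T‖ * ‖p i‖ ^ 2 := by
      calc _ ≤ ‖T (p i)‖ * ‖p i‖ := real_inner_le_norm _ _
        _ ≤ ‖T‖ * ‖p i‖ * ‖p i‖ := by gcongr; exact T.le_opNorm _
        _ = _ := by ring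
    have h3 : inner ℝ (T (p i)) (f i) = inner ℝ (T (f i)) (p i) := by
      rw [hT, real_inner_comm]
    rw [map_sub, inner_sub_left, inner_sub_right, inner_sub_right, h3]
    linarith
  have hlim1 : Tendsto (fun i => a * ‖f i - p i‖ ^ 2) l (𝓝 (a * 1)) := by
    refine Tendsto.const_mul _ ?_
    have h1 : Tendsto (fun i => ‖f i - p i‖) l (𝓝 1) := by
      refine tendsto_of_tendsto_of_tendsto_of_le_of_le (g := fun i => 1 - ‖p i‖)
        (h := fun i => 1 + ‖p i‖) ?_ ?_ (fun i => ?_) fun i => ?_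
      · simpa using hpn.const_sub 1
      · simpa using hpn.const_add 1
      · simpa [hf] using norm_sub_norm_le (f i) (p i)
      · simpa [hf] using norm_sub_le (f i) (p i)
    simpa using h1.pow 2
  have hlim2 : Tendsto (fun i => c + (2 * ‖T‖ * ‖p i‖ + ‖T‖ * ‖p i‖ ^ 2)) l (𝓝 (c + (2 * ‖T‖ * 0 + ‖T‖ * 0 ^ 2))) :=
    ((hpn.const_mul _).add ((hpn.pow 2).const_mul _)).const_add _
  have := le_of_tendsto_of_tendsto hlim1 hlim2
    (hform.mono fun i hi => (hbound i).trans (by linarith))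
  simpa using this

end SymmetricOperator

/-! ### The energy form for the normalizing measure and its bounded operator. -/

namespace WeightedGraph

variable {X : Type*} (G : WeightedGraph X)

/-- The square of the norm of `ℓ²(X, m)`, as an extended nonnegative number. -/
noncomputable def normSq (f : X → ℝ) : ℝ≥0∞ := ∑' x, ENNReal.ofReal (G.m x * f x ^ 2)

theorem tsum_ofReal_b (hnorm : ∀ x, G.m x = ∑' y, G.b x y) (x : X) :
    ∑' y, ENNReal.ofReal (G.b x y) = ENNReal.ofReal (G.m x) := by
  rw [hnorm, ENNReal.ofReal_tsum_of_nonneg (G.b_nonneg x) (G.b_summable x)]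

theorem tsum_tsum_left (hnorm : ∀ x, G.m x = ∑' y, G.b x y) (f : X → ℝ) :
    ∑' x, ∑' y, ENNReal.ofReal (G.b x y * f x ^ 2) = G.normSq f := by
  unfold normSq
  refine tsum_congr fun x => ?_
  simp only [ENNReal.ofReal_mul (G.b_nonneg _ _), ENNReal.ofReal_mul (G.m_pos _).le]
  rw [ENNReal.tsum_mul_right, G.tsum_ofReal_b hnorm]

theorem tsum_tsum_right (hnorm : ∀ x, G.m x = ∑' y, G.b x y) (f : X → ℝ) :
    ∑' x, ∑' y, ENNReal.ofReal (G.b x y * f y ^ 2) = G.normSq f := by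
  rw [ENNReal.tsum_comm, ← G.tsum_tsum_left hnorm]
  refine tsum_congr fun x => tsum_congr fun y => ?_
  rw [G.b_symm]

/-- A pointwise estimate of the gradient by function values gives an estimate of the energy. -/
theorem energy_le_of_forall (hnorm : ∀ x, G.m x = ∑' y, G.b x y) {f h : X → ℝ} {c : ℝ}
    (hc : 0 ≤ c) (hfh : ∀ x y, 0 < G.b x y →
      (f x - f y) ^ 2 ≤ c * (f x ^ 2 + f y ^ 2) + (h x ^ 2 + h y ^ 2)) :
    G.energy f ≤ ENNReal.ofReal c * G.normSq f + G.normSq h := by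
  have h1 : ∀ x y, ENNReal.ofReal (G.b x y * (f x - f y) ^ 2) ≤
      ENNReal.ofReal c * (ENNReal.ofReal (G.b x y * f x ^ 2) + ENNReal.ofReal (G.b x y * f y ^ 2)) +
      (ENNReal.ofReal (G.b x y * h x ^ 2) + ENNReal.ofReal (G.b x y * h y ^ 2)) := by
    intro x y
    have hb := G.b_nonneg x y
    rw [← ENNReal.ofReal_add (by positivity) (by positivity),
      ← ENNReal.ofReal_add (by positivity) (by positivity), ← ENNReal.ofReal_mul hc,
      ← ENNReal.ofReal_add (by positivity) (by positivity)]
    refine ENNReal.ofReal_le_ofReal ?_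
    rcases hb.eq_or_lt with h0 | h0
    · simp [← h0]
    · calc _ ≤ G.b x y * (c * (f x ^ 2 + f y ^ 2) + (h x ^ 2 + h y ^ 2)) := by
            gcongr; exact hfh x y h0
        _ = _ := by ring
  -- Rows and columns of `b` both sum to `m`, so each square is counted twice; this cancels the
  -- factor `1/2`.
  calc G.energy f ≤ 2⁻¹ * (ENNReal.ofReal c * (G.normSq f + G.normSq f) +
        (G.normSq h + G.normSq h)) := by
        unfold energy
        gcongr
        refine (ENNReal.tsum_le_tsum fun x => ENNReal.tsum_le_tsum fun y => h1 x y).trans_eq ?_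
        simp only [ENNReal.tsum_add, ENNReal.tsum_mul_left]
        rw [G.tsum_tsum_left hnorm, G.tsum_tsum_left hnorm, G.tsum_tsum_right hnorm,
          G.tsum_tsum_right hnorm]
    _ = (2⁻¹ * 2) * (ENNReal.ofReal c * G.normSq f + G.normSq h) := by ring
    _ = _ := by rw [ENNReal.inv_mul_cancel (by simp) (by simp), one_mul]

theorem energy_le_two_mul (hnorm : ∀ x, G.m x = ∑' y, G.b x y) (f : X → ℝ) :
    G.energy f ≤ 2 * G.normSq f := by
  have h := G.energy_le_of_forall hnorm (f := f) (h := 0) (c := 2) (by norm_num) fun x y _ => by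
    simp only [Pi.zero_apply]
    nlinarith [sq_nonneg (f x + f y)]
  simpa [normSq] using h

theorem energyForm_comm (u v : X → ℝ) : G.energyForm u v = G.energyForm v u := by
  unfold energyForm
  congr 1
  exact tsum_congr fun p => by ring

theorem energyForm_self (u : X → ℝ) (hu : G.energy u < ∞) :
    ENNReal.ofReal (G.energyForm u u) = G.energy u := by
  unfold energyForm energy
  have h : ∀ p : X × X, G.b p.1 p.2 * (u p.1 - u p.2) * (u p.1 - u p.2) =
      G.b p.1 p.2 * (u p.1 - u p.2) ^ 2 := fun p => by ring
  simp only [h]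
  rw [ENNReal.ofReal_mul (by norm_num), ENNReal.ofReal_tsum_of_nonneg
    (fun p => mul_nonneg (G.b_nonneg _ _) (sq_nonneg _)) (G.summable_sq_of_energy hu),
    ENNReal.tsum_prod' (f := fun p : X × X => ENNReal.ofReal (G.b p.1 p.2 * (u p.1 - u p.2) ^ 2))]
  congr 1
  rw [one_div, ENNReal.ofReal_inv_of_pos (by norm_num)]
  simp

theorem energyForm_self_nonneg (u : X → ℝ) : 0 ≤ G.energyForm u u := by
  unfold energyForm
  refine mul_nonneg (by norm_num) (tsum_nonneg fun p => ?_)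
  rw [mul_assoc]
  exact mul_nonneg (G.b_nonneg _ _) (mul_self_nonneg _)

variable [MeasurableSpace X] [DiscreteMeasurableSpace X]

theorem lintegral_measure (g : X → ℝ≥0∞) :
    ∫⁻ x, g x ∂G.measure = ∑' x, ENNReal.ofReal (G.m x) * g x := by
  rw [measure, lintegral_sum_measure]
  refine tsum_congr fun x => ?_
  rw [lintegral_smul_measure, lintegral_dirac, smul_eq_mul]

theorem lintegral_sq (f : X → ℝ) :
    ∫⁻ x, ENNReal.ofReal (f x ^ 2) ∂G.measure = G.normSq f := by
  rw [lintegral_measure]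
  exact tsum_congr fun x => (ENNReal.ofReal_mul (G.m_pos x).le).symm

theorem measure_eq_tsum (A : Set X) :
    G.measure A = ∑' x, ENNReal.ofReal (G.m x) * A.indicator 1 x := by
  rw [← lintegral_measure, lintegral_indicator_one .of_discrete]

theorem normSq_coe (u : G.L2) : G.normSq u = ENNReal.ofReal (‖u‖ ^ 2) := by
  have hint := L2.integrable_inner (𝕜 := ℝ) u u
  simp only [real_inner_self_eq_norm_sq, Real.norm_eq_abs, sq_abs] at hint
  rw [← real_inner_self_eq_norm_sq, L2.inner_def]
  simp only [real_inner_self_eq_norm_sq, Real.norm_eq_abs, sq_abs]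
  rw [ofReal_integral_eq_lintegral_ofReal hint (ae_of_all _ fun x => sq_nonneg _), lintegral_sq]

theorem exists_coe_eq [Countable X] {f : X → ℝ} (hf : G.normSq f ≠ ∞) : ∃ u : G.L2, (u : X → ℝ) = f := by
  have hm : AEStronglyMeasurable f G.measure := (measurable_of_countable f).aestronglyMeasurable
  have hm2 : AEStronglyMeasurable (fun x => f x ^ 2) G.measure :=
    (measurable_of_countable _).aestronglyMeasurable
  have h : MemLp f 2 G.measure := by
    rw [memLp_two_iff_integrable_sq hm,
      ← lintegral_ofReal_ne_top_iff_integrable hm2 (ae_of_all _ fun x => sq_nonneg _),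
      lintegral_sq]
    exact hf
  exact ⟨h.toLp f, G.eq_of_ae_eq h.coeFn_toLp⟩

theorem exists_delta (x : X) : ∃ δ : G.L2, (⇑δ : X → ℝ) = ({x} : Set X).indicator (fun _ => 1) ∧
    ∀ u : G.L2, inner ℝ δ u = G.m x * u x := by
  have hfin : G.measure {x} ≠ ∞ := by rw [measure_singleton]; exact ENNReal.ofReal_ne_top
  refine ⟨indicatorConstLp 2 (MeasurableSet.of_discrete (s := {x})) hfin (1 : ℝ),
    G.eq_of_ae_eq indicatorConstLp_coeFn, fun u => ?_⟩
  rw [L2.inner_indicatorConstLp_one, integral_singleton, measureReal_def,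
    measure_singleton, ENNReal.toReal_ofReal (G.m_pos x).le, smul_eq_mul]

/-- The span of the point functions. -/
noncomputable def deltaSpan : Submodule ℝ G.L2 :=
  Submodule.span ℝ {δ | ∃ x, (⇑δ : X → ℝ) = ({x} : Set X).indicator fun _ => 1}

theorem deltaSpan_topologicalClosure : G.deltaSpan.topologicalClosure = ⊤ := by
  rw [Submodule.topologicalClosure_eq_top_iff, Submodule.eq_bot_iff]
  intro u hu
  refine Lp.ext ?_
  rw [coe_zero]
  refine ae_of_all _ fun x => ?_
  obtain ⟨δ, hδ, h⟩ := G.exists_delta x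
  have := (Submodule.mem_orthogonal _ _).mp hu δ (Submodule.subset_span ⟨x, hδ⟩)
  rw [h] at this
  simpa [(G.m_pos x).ne'] using this

theorem support_finite_of_mem_deltaSpan {φ : G.L2} (hφ : φ ∈ G.deltaSpan) :
    (Function.support (φ : X → ℝ)).Finite := by
  induction hφ using Submodule.span_induction with
  | mem δ h =>
    obtain ⟨x, hx⟩ := h
    rw [hx]
    exact (finite_singleton x).subset Set.support_indicator_subset
  | zero => rw [coe_zero]; simp
  | add u v _ _ hu hv => rw [coe_add]; exact (hu.union hv).subset (Function.support_add _ _)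
  | smul c u _ hu => rw [coe_smul]; exact hu.subset (Function.support_const_smul_subset c _)

theorem energy_coe_le (hnorm : ∀ x, G.m x = ∑' y, G.b x y) (u : G.L2) :
    G.energy u ≤ ENNReal.ofReal (2 * ‖u‖ ^ 2) := by
  refine (G.energy_le_two_mul hnorm u).trans_eq ?_
  rw [normSq_coe, ENNReal.ofReal_mul (by norm_num)]
  simp

theorem energy_coe_lt_top (hnorm : ∀ x, G.m x = ∑' y, G.b x y) (u : G.L2) : G.energy u < ∞ :=
  (G.energy_coe_le hnorm u).trans_lt ENNReal.ofReal_lt_top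

/-- The energy is bounded by `2‖u‖²`, so the form norm is equivalent to the `ℓ²` norm, for which
finitely supported functions are dense. -/
theorem formDomain_eq_top (hnorm : ∀ x, G.m x = ∑' y, G.b x y) : G.formDomain = ⊤ := by
  refine Submodule.eq_top_iff'.mpr fun u => ⟨G.energy_coe_lt_top hnorm u, fun ε hε => ?_⟩
  have hu : u ∈ closure (G.deltaSpan : Set G.L2) := by
    have : u ∈ G.deltaSpan.topologicalClosure := by rw [deltaSpan_topologicalClosure]; trivial
    exact this
  have hlim : Tendsto (fun φ : G.L2 => ENNReal.ofReal (‖u - φ‖ ^ 2) +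
      ENNReal.ofReal (2 * ‖u - φ‖ ^ 2)) (𝓝 u) (𝓝 0) := by
    have hc : Continuous fun φ : G.L2 => ENNReal.ofReal (‖u - φ‖ ^ 2) +
      ENNReal.ofReal (2 * ‖u - φ‖ ^ 2) :=
      (ENNReal.continuous_ofReal.comp (by fun_prop)).add
        (ENNReal.continuous_ofReal.comp (by fun_prop))
    simpa using hc.tendsto u
  obtain ⟨φ, hφ, hmem⟩ := (mem_closure_iff_frequently.mp hu).and_eventually
    (hlim.eventually_lt_const hε) |>.exists
  refine ⟨φ, G.support_finite_of_mem_deltaSpan hφ, lt_of_le_of_lt ?_ hmem⟩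
  unfold formNormSq
  gcongr
  exact G.energy_coe_le hnorm _

/-- For the normalizing measure the Laplacian is a bounded symmetric operator on all of `ℓ²`. -/
theorem exists_bounded_laplacian (hnorm : ∀ x, G.m x = ∑' y, G.b x y) :
    ∃ T : G.L2 →L[ℝ] G.L2, (∀ u v, inner ℝ (T u) v = inner ℝ u (T v)) ∧
      (∀ u, inner ℝ (T u) u = G.energyForm u u) ∧
      ∀ u v, (u, v) ∈ G.laplacian.graph ↔ v = T u := by
  have hfin := G.energy_coe_lt_top hnorm
  let B : G.L2 →ₗ[ℝ] G.L2 →ₗ[ℝ] ℝ := LinearMap.mk₂ ℝ (fun u v => G.energyForm u v)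
    (fun u v w => by rw [coe_add, G.energyForm_add_left (hfin u) (hfin v) (hfin w)])
    (fun c u v => by rw [coe_smul, energyForm_smul_left, smul_eq_mul])
    (fun u v w => by
      rw [coe_add, energyForm_comm, G.energyForm_add_left (hfin v) (hfin w) (hfin u),
        G.energyForm_comm v, G.energyForm_comm w])
    (fun c u v => by rw [coe_smul, energyForm_comm, energyForm_smul_left, smul_eq_mul,
      energyForm_comm])
  have hB : ∀ u v, B u v = G.energyForm u v := fun u v => rfl
  have hself : ∀ u : G.L2, G.energyForm u u ≤ 2 * ‖u‖ ^ 2 := fun u => by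
    rw [← ENNReal.ofReal_le_ofReal_iff (by positivity), G.energyForm_self _ (hfin u)]
    exact G.energy_coe_le hnorm u
  -- Cauchy–Schwarz for the nonnegative form; this continuity is what the Riesz representation of
  -- `T` needs.
  have hbound : ∀ u v, ‖B u v‖ ≤ 2 * ‖u‖ * ‖v‖ := by
    intro u v
    have h := LinearMap.BilinForm.apply_sq_le_of_symm B
      (fun u => G.energyForm_self_nonneg u) ⟨fun u v => G.energyForm_comm u v⟩ u v
    rw [Real.norm_eq_abs]
    refine abs_le_of_sq_le_sq (h.trans ?_) (by positivity)
    rw [hB, hB]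
    calc _ ≤ (2 * ‖u‖ ^ 2) * (2 * ‖v‖ ^ 2) :=
          mul_le_mul (hself u) (hself v) (G.energyForm_self_nonneg _) (by positivity)
      _ = _ := by ring
  let T := InnerProductSpace.continuousLinearMapOfBilin (𝕜 := ℝ) (B.mkContinuous₂ 2 hbound)
  have hT : ∀ u v, inner ℝ (T u) v = G.energyForm u v := fun u v =>
    InnerProductSpace.continuousLinearMapOfBilin_apply _ u v
  refine ⟨T, fun u v => ?_, fun u => hT u u, fun u v => ?_⟩
  · rw [hT, real_inner_comm, hT, energyForm_comm]
  · rw [laplacian_graph]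
    constructor
    · rintro ⟨-, h⟩
      refine ext_inner_right ℝ fun w => ?_
      rw [hT]
      exact (h w (by rw [G.formDomain_eq_top hnorm]; trivial)).symm
    · rintro rfl
      exact ⟨by rw [G.formDomain_eq_top hnorm]; trivial, fun w _ => (hT u w).symm⟩

end WeightedGraph

/-! ### From the spectrum of the partially defined operator to invertibility of `T - c`. -/

namespace UnboundedOperator

variable {H : Type*} [NormedAddCommGroup H] [NormedSpace ℝ H] {A : H →ₗ.[ℝ] H} {T : H →L[ℝ] H}

theorem mem_domain_of_graph (hA : ∀ u v, (u, v) ∈ A.graph ↔ v = T u) (u : H) : u ∈ A.domain :=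
  LinearPMap.mem_domain_iff.mpr ⟨T u, (hA _ _).mpr rfl⟩

theorem apply_eq_of_graph (hA : ∀ u v, (u, v) ∈ A.graph ↔ v = T u) (u : A.domain) :
    A u = T u := (hA _ _).mp (A.mem_graph u)

theorem isUnit_of_isResolventPoint (hA : ∀ u v, (u, v) ∈ A.graph ↔ v = T u) {c : ℝ}
    (h : IsResolventPoint A c) : IsUnit (T - c • (1 : H →L[ℝ] H)) := by
  obtain ⟨R, h1, h2⟩ := h
  refine isUnit_iff_exists.mpr ⟨R, ?_, ?_⟩
  · ext v
    obtain ⟨hv, h⟩ := h2 v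
    rw [apply_eq_of_graph hA] at h
    simpa using h
  · ext u
    have h := h1 ⟨u, mem_domain_of_graph hA u⟩
    rw [apply_eq_of_graph hA] at h
    simpa using h

theorem finiteDimensional_ker (hA : ∀ u v, (u, v) ∈ A.graph ↔ v = T u) {c : ℝ}
    (h : FiniteDimensional ℝ (eigenspace A c)) :
    FiniteDimensional ℝ (LinearMap.ker ((T - c • (1 : H →L[ℝ] H) : H →L[ℝ] H) : H →ₗ[ℝ] H)) := by
  have hmem : ∀ u : H, u ∈ LinearMap.ker ((T - c • (1 : H →L[ℝ] H) : H →L[ℝ] H) : H →ₗ[ℝ] H) →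
      ∃ w : eigenspace A c, ((w : A.domain) : H) = u := by
    intro u hu
    refine ⟨⟨⟨u, mem_domain_of_graph hA u⟩, ?_⟩, rfl⟩
    have h := apply_eq_of_graph hA ⟨u, mem_domain_of_graph hA u⟩
    rw [eigenspace, LinearMap.mem_ker]
    simp only [LinearMap.sub_apply, LinearMap.smul_apply, Submodule.subtype_apply]
    have h' : A.toFun ⟨u, mem_domain_of_graph hA u⟩ = T u := h
    rw [h']
    simpa using hu
  have hle : LinearMap.ker ((T - c • (1 : H →L[ℝ] H) : H →L[ℝ] H) : H →ₗ[ℝ] H) ≤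
      (eigenspace A c).map A.domain.subtype := fun u hu => by
    obtain ⟨w, hw⟩ := hmem u hu
    exact ⟨w, w.2, hw⟩
  exact Submodule.finiteDimensional_of_le hle

theorem isUnit_of_lt_bottom (hA : ∀ u v, (u, v) ∈ A.graph ↔ v = T u) {c : ℝ}
    (hc : (c : EReal) < bottom A) : IsUnit (T - c • (1 : H →L[ℝ] H)) := by
  refine isUnit_of_isResolventPoint hA ?_
  by_contra h
  exact absurd (iInf₂_le c h) (not_le.mpr hc)

/-- Such a point either lies in the discrete spectrum, where both claims are part of the definition,
or is a resolvent point, where the kernel is trivial and invertibility is an open condition. -/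
theorem isolated_of_lt_essentialBottom [CompleteSpace H]
    (hA : ∀ u v, (u, v) ∈ A.graph ↔ v = T u) {c : ℝ}
    (hc : (c : EReal) < essentialBottom A) :
    FiniteDimensional ℝ (LinearMap.ker ((T - c • (1 : H →L[ℝ] H) : H →L[ℝ] H) : H →ₗ[ℝ] H)) ∧
      ∃ ε > 0, ∀ c', c' ≠ c → |c' - c| < ε → IsUnit (T - c' • (1 : H →L[ℝ] H)) := by
  have hnot : c ∉ essentialSpectrum A := fun h => absurd (iInf₂_le c h) (not_le.mpr hc)
  by_cases hs : c ∈ spectrum A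
  · have hd : c ∈ discreteSpectrum A := by
      by_contra h
      exact hnot ⟨hs, h⟩
    obtain ⟨-, ⟨ε, hε, h⟩, -, hfd⟩ := hd
    refine ⟨finiteDimensional_ker hA hfd, ε, hε, fun c' hne hlt =>
      isUnit_of_isResolventPoint hA ?_⟩
    by_contra hc'
    exact hne (h c' hc' hlt)
  · have hu : IsUnit (T - c • (1 : H →L[ℝ] H)) := isUnit_of_isResolventPoint hA (not_not.mp hs)
    constructor
    · have : LinearMap.ker ((T - c • (1 : H →L[ℝ] H) : H →L[ℝ] H) : H →ₗ[ℝ] H) = ⊥ := by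
        obtain ⟨R, -, hR⟩ := isUnit_iff_exists.mp hu
        refine (Submodule.eq_bot_iff _).mpr fun u hu => ?_
        have h := congrArg (fun B : H →L[ℝ] H => B u) hR
        have h0 : (T - c • (1 : H →L[ℝ] H)) u = 0 := hu
        simpa [h0] using h.symm
      rw [this]; infer_instance
    · have hopen : IsOpen {c' : ℝ | IsUnit (T - c' • (1 : H →L[ℝ] H))} :=
        Units.isOpen.preimage (f := fun c' : ℝ => T - c' • (1 : H →L[ℝ] H)) (by fun_prop)
      obtain ⟨ε, hε, h⟩ := Metric.isOpen_iff.mp hopen c hu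
      exact ⟨ε, hε, fun c' _ hlt => h (by rwa [Metric.mem_ball, Real.dist_eq])⟩

end UnboundedOperator

/-! ### Test function bounds for the two spectral bottoms. -/

/-- A family of unit vectors is weakly null if it is so on a total set. -/
theorem tendsto_inner_zero_of_span {H : Type*} [NormedAddCommGroup H] [InnerProductSpace ℝ H]
    {ι : Type*} {l : Filter ι} {D : Set H} (hD : (Submodule.span ℝ D).topologicalClosure = ⊤)
    {v : ι → H} (hv : ∀ i, ‖v i‖ = 1) (h : ∀ g ∈ D, Tendsto (fun i => inner ℝ g (v i)) l (𝓝 0))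
    (g : H) : Tendsto (fun i => inner ℝ g (v i)) l (𝓝 0) := by
  have hspan : ∀ g ∈ Submodule.span ℝ D, Tendsto (fun i => inner ℝ g (v i)) l (𝓝 0) := by
    intro g hg
    induction hg using Submodule.span_induction with
    | mem g hg => exact h g hg
    | zero => simpa using tendsto_const_nhds
    | add g g' _ _ h1 h2 => simpa [inner_add_left] using h1.add h2
    | smul c g _ h1 => simpa [real_inner_smul_left] using h1.const_mul c
  rw [Metric.tendsto_nhds]
  intro ε hε
  have hg : g ∈ closure (Submodule.span ℝ D : Set H) := by
    have : g ∈ (Submodule.span ℝ D).topologicalClosure := by rw [hD]; trivial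
    exact this
  obtain ⟨g', hg', hlt⟩ := Metric.mem_closure_iff.mp hg (ε / 2) (by positivity)
  filter_upwards [Metric.tendsto_nhds.mp (hspan g' hg') (ε / 2) (by positivity)] with i hi
  rw [Real.dist_eq, sub_zero] at hi ⊢
  have h1 : inner ℝ g (v i) = inner ℝ (g - g') (v i) + inner ℝ g' (v i) := by
    rw [inner_sub_left]; ring
  have h2 : |inner ℝ (g - g') (v i)| ≤ ‖g - g'‖ := by
    simpa [hv] using abs_real_inner_le_norm (g - g') (v i)
  rw [dist_eq_norm] at hlt
  rw [h1]
  exact (abs_add_le _ _).trans_lt (by linarith)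

namespace WeightedGraph

variable {X : Type*} [Countable X] [MeasurableSpace X] [DiscreteMeasurableSpace X]
  (G : WeightedGraph X)

theorem exists_coe_eq_of_energy_le (hnorm : ∀ x, G.m x = ∑' y, G.b x y) {f : X → ℝ} {c : ℝ}
    (hc : 0 ≤ c) (h0 : G.normSq f ≠ 0) (htop : G.normSq f ≠ ∞)
    (hE : G.energy f ≤ ENNReal.ofReal c * G.normSq f) :
    ∃ u : G.L2, (u : X → ℝ) = f ∧ 0 < ‖u‖ ∧ G.energyForm u u ≤ c * ‖u‖ ^ 2 := by
  obtain ⟨u, rfl⟩ := G.exists_coe_eq htop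
  refine ⟨u, rfl, ?_, ?_⟩
  · rw [normSq_coe, ne_eq, ENNReal.ofReal_eq_zero, not_le] at h0
    exact (norm_nonneg _).lt_of_ne fun h => by simp [← h] at h0
  · rw [normSq_coe, ← ENNReal.ofReal_mul hc,
      ← G.energyForm_self _ (G.energy_coe_lt_top hnorm u)] at hE
    exact (ENNReal.ofReal_le_ofReal_iff (by positivity)).mp hE

/-- The variational upper bound for the bottom of the spectrum. -/
theorem bottom_le_of_energy_le (hnorm : ∀ x, G.m x = ∑' y, G.b x y) {c : ℝ} (hc : 0 ≤ c)
    (h : ∀ ε > 0, ∃ f : X → ℝ, G.normSq f ≠ 0 ∧ G.normSq f ≠ ∞ ∧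
      G.energy f ≤ ENNReal.ofReal (c + ε) * G.normSq f) :
    UnboundedOperator.bottom G.laplacian ≤ c := by
  obtain ⟨T, hT, hTE, hgraph⟩ := G.exists_bounded_laplacian hnorm
  by_contra! hlt
  obtain ⟨b, hcb, hb⟩ := EReal.lt_iff_exists_real_btwn.mp hlt
  rw [EReal.coe_lt_coe_iff] at hcb
  -- Continuation starts at the trivial lower bound `0`; all of `[0, b)` lies below the spectrum.
  have hform := SymmetricOperator.form_ge_of_isUnit hT (hc.trans hcb.le)
    (fun u => by rw [hTE, zero_mul]; exact G.energyForm_self_nonneg u)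
    (fun c' _ hc' => UnboundedOperator.isUnit_of_lt_bottom hgraph
      ((EReal.coe_lt_coe_iff.mpr hc').trans hb))
  obtain ⟨f, h0, htop, hE⟩ := h ((b - c) / 2) (by linarith)
  obtain ⟨u, -, hu0, hu⟩ := G.exists_coe_eq_of_energy_le hnorm (by linarith) h0 htop hE
  have := hform u
  rw [hTE] at this
  nlinarith [pow_pos hu0 2]

/-- The variational upper bound for the bottom of the essential spectrum, through test functions
whose mass escapes from all finite sets. -/
theorem essentialBottom_le_of_energy_le (hnorm : ∀ x, G.m x = ∑' y, G.b x y) {c : ℝ} (hc : 0 ≤ c)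
    (h : ∀ ε > 0, ∀ K : Finset X, ∃ f : X → ℝ, G.normSq f ≠ 0 ∧ G.normSq f ≠ ∞ ∧
      G.energy f ≤ ENNReal.ofReal (c + ε) * G.normSq f ∧
      ∀ y ∈ K, ENNReal.ofReal (G.m y * f y ^ 2) ≤ ENNReal.ofReal ε * G.normSq f) :
    UnboundedOperator.essentialBottom G.laplacian ≤ c := by
  classical
  obtain ⟨T, hT, hTE, hgraph⟩ := G.exists_bounded_laplacian hnorm
  by_contra! hlt
  obtain ⟨b, hcb, hb⟩ := EReal.lt_iff_exists_real_btwn.mp hlt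
  rw [EReal.coe_lt_coe_iff] at hcb
  obtain ⟨W, hW, hform⟩ := SymmetricOperator.exists_finiteDimensional_form_ge hT (b := b)
    (fun c' hc' => UnboundedOperator.isolated_of_lt_essentialBottom hgraph
      ((EReal.coe_lt_coe_iff.mpr hc').trans hb)) (a := (b + c) / 2) (by linarith)
  -- The index records a finite set on which the mass is small and the tolerance `1 / (n + 1)`, so
  -- that `atTop` on pairs exhausts both.
  have hex : ∀ p : Finset X × ℕ, ∃ u : G.L2, 0 < ‖u‖ ∧
      G.energyForm u u ≤ (c + 1 / ((p.2 : ℝ) + 1)) * ‖u‖ ^ 2 ∧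
      ∀ y ∈ p.1, G.m y * u y ^ 2 ≤ 1 / ((p.2 : ℝ) + 1) * ‖u‖ ^ 2 := by
    rintro ⟨K, n⟩
    have hn : (0 : ℝ) < 1 / ((n : ℝ) + 1) := by positivity
    obtain ⟨f, h0, htop, hE, hK⟩ := h _ hn K
    obtain ⟨u, rfl, hu0, hu⟩ := G.exists_coe_eq_of_energy_le hnorm (by linarith) h0 htop hE
    refine ⟨u, hu0, hu, fun y hy => ?_⟩
    have := hK y hy
    rw [normSq_coe, ← ENNReal.ofReal_mul hn.le] at this
    exact (ENNReal.ofReal_le_ofReal_iff (by positivity)).mp this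
  choose u hu0 hu huK using hex
  set v : Finset X × ℕ → G.L2 := fun p => ‖u p‖⁻¹ • u p
  have hv : ∀ p, ‖v p‖ = 1 := fun p => by
    rw [norm_smul, norm_inv, norm_norm, inv_mul_cancel₀ (hu0 p).ne']
  have hlim : Tendsto (fun p : Finset X × ℕ => 1 / ((p.2 : ℝ) + 1)) atTop (𝓝 0) := by
    rw [← prod_atTop_atTop_eq]
    exact tendsto_one_div_add_atTop_nhds_zero_nat.comp tendsto_snd
  have hweak := tendsto_inner_zero_of_span (l := atTop) G.deltaSpan_topologicalClosure hv (by
    rintro δ ⟨x, hδ⟩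
    obtain ⟨δ', hδ', hin⟩ := G.exists_delta x
    obtain rfl : δ = δ' := Lp.ext (by rw [hδ, hδ'])
    have hsq : Tendsto (fun p : Finset X × ℕ => √(G.m x * (1 / ((p.2 : ℝ) + 1)))) atTop (𝓝 0) := by
      simpa using (hlim.const_mul (G.m x)).sqrt
    refine squeeze_zero_norm' ?_ hsq
    filter_upwards [eventually_ge_atTop (({x} : Finset X), 0)] with p hp
    rw [Real.norm_eq_abs]
    refine Real.abs_le_sqrt ?_
    have hx := huK p x (hp.1 (Finset.mem_singleton_self x))
    have hm := G.m_pos x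
    have hp0 := hu0 p
    rw [real_inner_smul_right, hin]
    calc _ = G.m x * (G.m x * u p x ^ 2) * (‖u p‖⁻¹) ^ 2 := by ring
      _ ≤ G.m x * (1 / ((p.2 : ℝ) + 1) * ‖u p‖ ^ 2) * (‖u p‖⁻¹) ^ 2 := by gcongr
      _ = _ := by field_simp)
  have hform' : ∀ᶠ p in atTop, inner ℝ (T (v p)) (v p) ≤ c + (b - c) / 4 := by
    filter_upwards [hlim.eventually_le_const (show 0 < (b - c) / 4 by linarith)] with p hp
    have hp0 := hu0 p
    rw [map_smul, real_inner_smul_left, real_inner_smul_right, hTE]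
    calc _ ≤ ‖u p‖⁻¹ * (‖u p‖⁻¹ * ((c + 1 / ((p.2 : ℝ) + 1)) * ‖u p‖ ^ 2)) := by
          gcongr; exact hu p
      _ = c + 1 / ((p.2 : ℝ) + 1) := by field_simp
      _ ≤ _ := by gcongr
  have := SymmetricOperator.le_of_weakly_null hT hform hv hweak hform'
  linarith

end WeightedGraph

/-! ### The bounding function and the growth rates. -/

namespace VolumeGrowth

theorem fujiwaraBound_coe (t : ℝ) :
    fujiwaraBound t = 1 - 2 * Real.exp (t / 2) / (1 + Real.exp t) := by
  rw [fujiwaraBound, if_neg (EReal.coe_ne_top t), EReal.toReal_coe]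

theorem fujiwaraBound_two_mul (α : ℝ) : fujiwaraBound ((2 * α : ℝ) : EReal) =
    (Real.exp α - 1) ^ 2 / (1 + Real.exp α ^ 2) := by
  have h : Real.exp (2 * α) = Real.exp α ^ 2 := by rw [← Real.exp_nat_mul]; norm_num
  rw [fujiwaraBound_coe, h, mul_div_cancel_left₀ _ two_ne_zero]
  field_simp
  ring

theorem fujiwaraBound_coe_nonneg (t : ℝ) : 0 ≤ fujiwaraBound t := by
  have := fujiwaraBound_two_mul (t / 2)
  rw [mul_div_cancel₀ _ two_ne_zero] at this
  rw [this]
  positivity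

theorem fujiwaraBound_two_mul_mono {α β : ℝ} (hα : 0 ≤ α) (hαβ : α ≤ β) :
    fujiwaraBound ((2 * α : ℝ) : EReal) ≤ fujiwaraBound ((2 * β : ℝ) : EReal) := by
  rw [fujiwaraBound_two_mul, fujiwaraBound_two_mul, div_le_div_iff₀ (by positivity) (by positivity)]
  have h1 : 1 ≤ Real.exp α := Real.one_le_exp hα
  have h2 : Real.exp α ≤ Real.exp β := Real.exp_le_exp.mpr hαβ
  have h3 : 1 ≤ Real.exp α * Real.exp β := one_le_mul_of_one_le_of_one_le h1 (h1.trans h2)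
  nlinarith [mul_nonneg (sub_nonneg.mpr h2) (sub_nonneg.mpr h3)]

/-- After clearing denominators this is `(e^α q - p) (e^α p - q) ≥ 0`. It is sharp when the ratio of
`p` and `q` is exactly `e^α`. -/
theorem sq_sub_le_fujiwaraBound_mul {α p q : ℝ} (hpq : p ≤ Real.exp α * q)
    (hqp : q ≤ Real.exp α * p) :
    (p - q) ^ 2 ≤ fujiwaraBound ((2 * α : ℝ) : EReal) * (p ^ 2 + q ^ 2) := by
  rw [fujiwaraBound_two_mul, div_mul_eq_mul_div, le_div_iff₀ (by positivity)]
  nlinarith [mul_nonneg (sub_nonneg.mpr hpq) (sub_nonneg.mpr hqp)]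

/-- A bound by the values at all exponents above the growth rate passes to the growth rate. -/
theorem le_fujiwaraBound {B t : EReal} (h1 : B ≤ 1)
    (h : ∀ γ γ' : ℝ, t < γ → 0 < γ → γ < γ' → B ≤ (fujiwaraBound γ' : EReal)) :
    B ≤ (fujiwaraBound t : EReal) := by
  by_cases ht : t = ⊤
  · simpa [fujiwaraBound, ht] using h1
  have hcont : Continuous fun s : ℝ => (fujiwaraBound s : EReal) := by
    simp only [fujiwaraBound_coe]
    refine continuous_coe_real_ereal.comp ?_
    refine continuous_const.sub (Continuous.div (by fun_prop) (by fun_prop) fun s => ?_)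
    positivity
  -- The hypothesis concerns positive exponents only, so the limit is taken from the right at `max t
  -- 0`. For negative `t` this suffices, because the bound vanishes at `0` and is nonnegative
  -- elsewhere.
  have hmax : B ≤ (fujiwaraBound (max t.toReal 0 : ℝ) : EReal) := by
    refine ge_of_tendsto ((hcont.tendsto (max t.toReal 0)).mono_left
      (nhdsWithin_le_nhds (s := Ioi (max t.toReal 0)))) ?_
    filter_upwards [self_mem_nhdsWithin] with γ' hγ'
    obtain ⟨γ, hγ, hγγ'⟩ := exists_between (mem_Ioi.mp hγ')
    refine h γ γ' ?_ ((le_max_right _ _).trans_lt hγ) hγγ'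
    exact (EReal.le_coe_toReal ht).trans_lt
      (EReal.coe_lt_coe_iff.mpr ((le_max_left _ _).trans_lt hγ))
  refine hmax.trans (EReal.coe_le_coe_iff.mpr ?_)
  have htt : fujiwaraBound t = fujiwaraBound (t.toReal : EReal) := by
    simp [fujiwaraBound, ht]
  rw [htt]
  rcases le_total t.toReal 0 with h0 | h0
  · rw [max_eq_right h0]
    refine le_trans (le_of_eq ?_) (fujiwaraBound_coe_nonneg _)
    rw [fujiwaraBound_coe]
    norm_num
  · rw [max_eq_left h0]

theorem ball_mono {X : Type*} (ρ : X → X → ℝ) (x : X) : Monotone (ball ρ x) :=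
  fun _ _ hrs _ hy => le_trans hy hrs

variable {X : Type*} [MeasurableSpace X]

/-- There are arbitrarily large balls of volume at most `exp (γ r)` relative to the unit ball with
the same centre. -/
def HasGrowthBelow (ν : Measure X) (ρ : X → X → ℝ) (γ : ℝ) : Prop :=
  ∃ᶠ r : ℝ in atTop, ∃ x, ν (ball ρ x 1) ≠ ∞ ∧
    ν (ball ρ x r) ≤ ENNReal.ofReal (Real.exp (γ * r)) * ν (ball ρ x 1)

theorem lt_mul_of_one_div_mul_lt {r γ : ℝ} (hr : 0 < r) {a : EReal}
    (h : ((1 / r : ℝ) : EReal) * a < γ) : a < ((γ * r : ℝ) : EReal) := by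
  induction a with
  | bot => exact EReal.bot_lt_coe _
  | top =>
    rw [EReal.coe_mul_top_of_pos (by positivity)] at h
    exact absurd h not_top_lt
  | coe a =>
    rw [← EReal.coe_mul, EReal.coe_lt_coe_iff] at h
    rw [EReal.coe_lt_coe_iff]
    rwa [one_div_mul_eq_div, div_lt_iff₀ hr] at h

theorem le_ofReal_exp_of_log_lt {a : ℝ≥0∞} {c : ℝ} (h : ENNReal.log a < c) :
    a ≤ ENNReal.ofReal (Real.exp c) := by
  rw [← EReal.exp_coe, ← ENNReal.exp_log a]
  exact EReal.exp_le_exp_iff.mpr h.le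

theorem hasGrowthBelow_of_minExpGrowth_lt {ν : Measure X} {ρ : X → X → ℝ} {γ : ℝ}
    (hpos : ∀ x, ν (ball ρ x 1) ≠ 0) (h : minExpGrowth ν ρ < γ) : HasGrowthBelow ν ρ γ := by
  refine ((frequently_lt_of_liminf_lt (by isBoundedDefault) h).and_eventually
    (eventually_gt_atTop 0)).mono ?_
  rintro r ⟨hr, hr0⟩
  obtain ⟨x, hx⟩ := iInf_lt_iff.mp (lt_mul_of_one_div_mul_lt hr0 hr)
  obtain ⟨hfin, hx⟩ := iInf_lt_iff.mp hx
  exact ⟨x, hfin, (ENNReal.div_le_iff (hpos x) hfin).mp (le_ofReal_exp_of_log_lt hx)⟩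

/-- The volume of the unit ball about `x₀` is a fixed positive quantity, absorbed for large `r` by
passing from an intermediate exponent `β` to `γ`. It is finite because a larger ball is. -/
theorem hasGrowthBelow_of_expGrowth_lt {ν : Measure X} {ρ : X → X → ℝ} {γ : ℝ} {x₀ : X}
    (hpos : ν (ball ρ x₀ 1) ≠ 0) (h : expGrowth ν ρ x₀ < γ) : HasGrowthBelow ν ρ γ := by
  obtain ⟨β, hβ, hβγ⟩ := EReal.lt_iff_exists_real_btwn.mp h
  rw [EReal.coe_lt_coe_iff] at hβγ
  have hev : ∀ᶠ r : ℝ in atTop, ENNReal.ofReal (Real.exp (-(γ - β) * r)) ≤ ν (ball ρ x₀ 1) := by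
    have h1 : Tendsto (fun r : ℝ => Real.exp (-(γ - β) * r)) atTop (𝓝 0) :=
      Real.tendsto_exp_atBot.comp (tendsto_id.const_mul_atTop_of_neg (by linarith))
    have h2 := (ENNReal.continuous_ofReal.tendsto 0).comp h1
    rw [ENNReal.ofReal_zero] at h2
    exact h2.eventually_le_const (pos_iff_ne_zero.mpr hpos)
  refine (((frequently_lt_of_liminf_lt (by isBoundedDefault) hβ).and_eventually
    (eventually_ge_atTop 1)).and_eventually hev).mono ?_
  rintro r ⟨⟨hr, hr1⟩, hrν⟩
  have hle := le_ofReal_exp_of_log_lt (lt_mul_of_one_div_mul_lt (by linarith) hr)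
  refine ⟨x₀, ne_top_of_le_ne_top ENNReal.ofReal_ne_top
    ((measure_mono (ball_mono ρ x₀ hr1)).trans hle), hle.trans ?_⟩
  calc ENNReal.ofReal (Real.exp (β * r))
      = ENNReal.ofReal (Real.exp (γ * r)) * ENNReal.ofReal (Real.exp (-(γ - β) * r)) := by
        rw [← ENNReal.ofReal_mul (Real.exp_pos _).le, ← Real.exp_add]
        congr 2; ring
    _ ≤ _ := by gcongr

end VolumeGrowth

/-! ### Exponentially decaying test functions and their energy. -/

theorem tendsto_exp_sub_zero {γ α : ℝ} (h : γ < 2 * α) (s : ℝ) :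
    Tendsto (fun r : ℝ => Real.exp (-(2 * α) * (r - s)) * Real.exp (γ * r)) atTop (𝓝 0) := by
  have h1 : Tendsto (fun r : ℝ => 2 * α * s + -(2 * α - γ) * r) atTop atBot :=
    tendsto_atBot_add_const_left _ _ (tendsto_id.const_mul_atTop_of_neg (by linarith))
  refine (Real.tendsto_exp_atBot.comp h1).congr fun r => ?_
  rw [← Real.exp_add, Function.comp_apply]
  congr 1; ring

namespace WeightedGraph

open VolumeGrowth

variable {X : Type*} (G : WeightedGraph X)

theorem natDist_le_add_one (hconn : G.graph.Connected) {y z : X} (h : 0 < G.b y z) (x : X) :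
    G.natDist y x ≤ G.natDist z x + 1 := by
  have h1 : G.graph.dist y z = 1 := SimpleGraph.dist_eq_one_iff_adj.mpr h
  have h2 := hconn.dist_triangle (u := y) (v := z) (w := x)
  unfold natDist
  exact_mod_cast (by omega : G.graph.dist y x ≤ G.graph.dist z x + 1)

theorem natDist_triangle (hconn : G.graph.Connected) (x y z : X) :
    G.natDist x z ≤ G.natDist x y + G.natDist y z := by
  unfold natDist; exact_mod_cast hconn.dist_triangle

/-- The function that equals `1` on the ball of radius `s`, decays exponentially with the distance
to it, and is cut off at radius `r`. -/
noncomputable def plateau (x : X) (α s r : ℝ) (z : X) : ℝ :=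
  open Classical in
  if z ∈ ball G.natDist x r then Real.exp (-α * max (G.natDist z x - s) 0) else 0

variable {G} in
theorem plateau_of_mem {x z : X} {α s r : ℝ} (h : z ∈ ball G.natDist x r) :
    G.plateau x α s r z = Real.exp (-α * max (G.natDist z x - s) 0) := if_pos h

variable {G} in
theorem plateau_of_notMem {x z : X} {α s r : ℝ} (h : z ∉ ball G.natDist x r) :
    G.plateau x α s r z = 0 := if_neg h

theorem plateau_nonneg (x z : X) (α s r : ℝ) : 0 ≤ G.plateau x α s r z := by
  unfold plateau; split_ifs <;> positivity

theorem plateau_le_one (x z : X) {α : ℝ} (hα : 0 < α) (s r : ℝ) : G.plateau x α s r z ≤ 1 := by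
  unfold plateau
  split_ifs
  · rw [Real.exp_le_one_iff]
    have := le_max_right (G.natDist z x - s) 0
    nlinarith
  · exact zero_le_one

theorem plateau_le_exp {x z : X} {α s r : ℝ} (hα : 0 < α) {t : ℝ}
    (h : t ≤ G.natDist z x - s) : G.plateau x α s r z ≤ Real.exp (-α * t) := by
  unfold plateau
  split_ifs
  · rw [Real.exp_le_exp]
    have := le_max_left (G.natDist z x - s) 0
    nlinarith
  · positivity

/-- The exponent is Lipschitz in the distance to `x`. Only `z` has to lie in the large ball, since
the function vanishes at `y` otherwise. Used with `t = 1` along edges and with larger `t` on balls.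
-/
theorem plateau_le_exp_mul {x y z : X} {α s r t : ℝ} (hα : 0 < α) (ht : 0 ≤ t)
    (hz : z ∈ ball G.natDist x r) (h : G.natDist z x ≤ G.natDist y x + t) :
    G.plateau x α s r y ≤ Real.exp (α * t) * G.plateau x α s r z := by
  by_cases hy : y ∈ ball G.natDist x r
  · rw [plateau_of_mem hy, plateau_of_mem hz, ← Real.exp_add, Real.exp_le_exp]
    have : max (G.natDist z x - s) 0 ≤ max (G.natDist y x - s) 0 + t :=
      max_le (by linarith [le_max_left (G.natDist y x - s) 0])
        (by linarith [le_max_right (G.natDist y x - s) 0])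
    nlinarith
  · rw [plateau_of_notMem hy]
    exact mul_nonneg (by positivity) (G.plateau_nonneg _ _ _ _ _)

theorem energy_indicator_le (hnorm : ∀ x, G.m x = ∑' y, G.b x y) (x : X) :
    G.energy (({x} : Set X).indicator fun _ => 1) ≤
      ENNReal.ofReal 1 * G.normSq (({x} : Set X).indicator fun _ => 1) := by
  have h := G.energy_le_of_forall hnorm (f := ({x} : Set X).indicator fun _ => 1) (h := 0)
    zero_le_one fun y z _ => by
      have h0 : ∀ w, 0 ≤ ({x} : Set X).indicator (fun _ => (1 : ℝ)) w := fun w =>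
        indicator_nonneg (fun _ _ => zero_le_one) w
      simp only [Pi.zero_apply]
      nlinarith [mul_nonneg (h0 y) (h0 z)]
  simpa [normSq] using h

theorem normSq_indicator (x : X) :
    G.normSq (({x} : Set X).indicator fun _ => 1) = ENNReal.ofReal (G.m x) := by
  unfold normSq
  rw [tsum_eq_single x fun y hy => by simp [hy]]
  simp

variable [MeasurableSpace X]

theorem tendsto_measure_ball (hinf : G.measure univ = ∞) (x : X) :
    Tendsto (fun k : ℕ => G.measure (ball G.natDist x k)) atTop (𝓝 ∞) := by
  have h := tendsto_measure_iUnion_atTop (μ := G.measure) (s := fun k : ℕ => ball G.natDist x k)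
    (fun _ _ hkl => ball_mono _ _ (by exact_mod_cast hkl))
  have hU : (⋃ k : ℕ, ball G.natDist x k) = univ :=
    eq_univ_of_forall fun y => mem_iUnion.mpr ⟨G.graph.dist y x, le_refl (G.natDist y x)⟩
  rwa [hU, hinf] at h

variable [DiscreteMeasurableSpace X]

theorem mul_measure_le_normSq {f : X → ℝ} {A : Set X} {a : ℝ} (ha : 0 ≤ a) (h : ∀ z ∈ A, a ≤ f z) :
    ENNReal.ofReal (a ^ 2) * G.measure A ≤ G.normSq f := by
  rw [measure_eq_tsum, ← ENNReal.tsum_mul_left]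
  unfold normSq
  refine ENNReal.tsum_le_tsum fun z => ?_
  by_cases hz : z ∈ A
  · have := h z hz
    rw [indicator_of_mem hz, Pi.one_apply, mul_one, mul_comm,
      ← ENNReal.ofReal_mul (G.m_pos z).le]
    have := (G.m_pos z).le
    gcongr
  · simp [indicator_of_notMem hz]

theorem normSq_le_mul_measure {f : X → ℝ} {A : Set X} {a : ℝ} (h : ∀ z, |f z| ≤ a)
    (h0 : ∀ z, z ∉ A → f z = 0) : G.normSq f ≤ ENNReal.ofReal (a ^ 2) * G.measure A := by
  rw [measure_eq_tsum, ← ENNReal.tsum_mul_left]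
  unfold normSq
  refine ENNReal.tsum_le_tsum fun z => ?_
  by_cases hz : z ∈ A
  · rw [indicator_of_mem hz, Pi.one_apply, mul_one, mul_comm (ENNReal.ofReal (a ^ 2)),
      ← ENNReal.ofReal_mul (G.m_pos z).le]
    have := (G.m_pos z).le
    rw [← sq_abs]
    have := h z
    gcongr
  · simp [h0 z hz]

theorem measure_ball_ne_zero (x : X) {r : ℝ} (hr : 0 ≤ r) :
    G.measure (ball G.natDist x r) ≠ 0 := by
  have h : G.measure {x} ≤ G.measure (ball G.natDist x r) :=
    measure_mono (by simpa [ball, natDist] using hr)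
  rw [measure_singleton] at h
  exact ((ENNReal.ofReal_pos.mpr (G.m_pos x)).trans_le h).ne'

theorem ofReal_m_le_measure {x : X} {A : Set X} (h : x ∈ A) :
    ENNReal.ofReal (G.m x) ≤ G.measure A := by
  rw [← measure_singleton]
  exact measure_mono (by simpa using h)

theorem measure_ball_le_normSq_plateau (x : X) (α : ℝ) {s r : ℝ} (hsr : s ≤ r) :
    G.measure (ball G.natDist x s) ≤ G.normSq (G.plateau x α s r) := by
  have h := G.mul_measure_le_normSq (f := G.plateau x α s r) (A := ball G.natDist x s)
    (a := 1) zero_le_one fun z hz => by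
      rw [plateau_of_mem (ball_mono _ _ hsr hz), max_eq_right (sub_nonpos.mpr hz)]
      simp
  simpa using h

theorem normSq_plateau_le_measure_ball (x : X) {α : ℝ} (hα : 0 < α) (s r : ℝ) :
    G.normSq (G.plateau x α s r) ≤ G.measure (ball G.natDist x r) := by
  have h := G.normSq_le_mul_measure (f := G.plateau x α s r) (A := ball G.natDist x r) (a := 1)
    (fun z => by rw [abs_of_nonneg (G.plateau_nonneg _ _ _ _ _)]; exact G.plateau_le_one _ _ hα _ _)
    fun z hz => plateau_of_notMem hz
  simpa using h

/-- The energy of a plateau function, up to a contribution of the boundary of the large ball. -/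
theorem energy_plateau_le (hconn : G.graph.Connected) (hnorm : ∀ x, G.m x = ∑' y, G.b x y)
    (x : X) {α : ℝ} (hα : 0 < α) (s r : ℝ) :
    G.energy (G.plateau x α s r) ≤
      ENNReal.ofReal (fujiwaraBound ((2 * α : ℝ) : EReal)) * G.normSq (G.plateau x α s r) +
      ENNReal.ofReal (Real.exp (-(2 * α) * (r - 1 - s))) * G.measure (ball G.natDist x r) := by
  classical
  set f := G.plateau x α s r with hf
  -- The error term pays for the jump at the cut-off: an edge leaving the ball has its inner end at
  -- distance more than `r - 1`, where `f` is at most this constant.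
  set h : X → ℝ := fun z => if z ∈ ball G.natDist x r then Real.exp (-α * (r - 1 - s)) else 0
    with hh
  have hF := fujiwaraBound_coe_nonneg (2 * α)
  have hcut : ∀ y z, 0 < G.b y z → y ∈ ball G.natDist x r → z ∉ ball G.natDist x r →
      f y ^ 2 ≤ h y ^ 2 := by
    intro y z hb hy hz
    have h1 : f y ≤ h y := by
      rw [hh]; simp only [if_pos hy]
      refine G.plateau_le_exp hα ?_
      have h1 := G.natDist_le_add_one hconn (G.b_symm y z ▸ hb) x
      have h2 : r < G.natDist z x := not_le.mp hz
      linarith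
    exact pow_le_pow_left₀ (G.plateau_nonneg _ _ _ _ _) h1 2
  refine (G.energy_le_of_forall hnorm (h := h) hF fun y z hb => ?_).trans ?_
  · by_cases hy : y ∈ ball G.natDist x r <;> by_cases hz : z ∈ ball G.natDist x r
    · have hyz := G.plateau_le_exp_mul (s := s) hα zero_le_one hz
        (G.natDist_le_add_one hconn (G.b_symm y z ▸ hb) x)
      have hzy := G.plateau_le_exp_mul (s := s) hα zero_le_one hy
        (G.natDist_le_add_one hconn hb x)
      rw [mul_one] at hyz hzy
      have h1 := sq_sub_le_fujiwaraBound_mul hyz hzy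
      exact h1.trans (le_add_of_nonneg_right (by positivity))
    · have h0 : f z = 0 := plateau_of_notMem hz
      have := hcut y z hb hy hz
      rw [h0, sub_zero]
      nlinarith [mul_nonneg hF (sq_nonneg (f y)), sq_nonneg (h z)]
    · have h0 : f y = 0 := plateau_of_notMem hy
      have := hcut z y (G.b_symm y z ▸ hb) hz hy
      rw [h0, zero_sub, neg_sq]
      nlinarith [mul_nonneg hF (sq_nonneg (f z)), sq_nonneg (h y)]
    · have h0 : f y = 0 := plateau_of_notMem hy
      have h0' : f z = 0 := plateau_of_notMem hz
      rw [h0, h0']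
      nlinarith [sq_nonneg (h y), sq_nonneg (h z)]
  · refine add_le_add le_rfl ?_
    have h1 := G.normSq_le_mul_measure (f := h) (A := ball G.natDist x r)
      (a := Real.exp (-α * (r - 1 - s)))
      (fun z => by
        rw [hh]; dsimp only
        split_ifs
        · rw [abs_of_pos (Real.exp_pos _)]
        · simpa using (Real.exp_pos _).le)
      fun z hz => if_neg hz
    refine h1.trans_eq ?_
    rw [← Real.exp_nat_mul]
    congr 3
    push_cast; ring

/-- Test functions centred at the centres of the balls of small relative volume. -/
theorem energy_plateau_one_le (hconn : G.graph.Connected) (hnorm : ∀ x, G.m x = ∑' y, G.b x y)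
    {γ α : ℝ} (hα : 0 < α) {x : X} {r ε : ℝ} (hr : 1 ≤ r) (hε : 0 < ε)
    (hx : G.measure (ball G.natDist x r) ≤
      ENNReal.ofReal (Real.exp (γ * r)) * G.measure (ball G.natDist x 1))
    (hrε : Real.exp (-(2 * α) * (r - 2)) * Real.exp (γ * r) ≤ ε) :
    G.energy (G.plateau x α 1 r) ≤
      ENNReal.ofReal (fujiwaraBound ((2 * α : ℝ) : EReal) + ε) *
        G.normSq (G.plateau x α 1 r) := by
  refine (G.energy_plateau_le hconn hnorm x hα 1 r).trans ?_
  rw [ENNReal.ofReal_add (fujiwaraBound_coe_nonneg _) hε.le, add_mul]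
  refine add_le_add le_rfl ?_
  calc _ ≤ ENNReal.ofReal (Real.exp (-(2 * α) * (r - 1 - 1))) *
        (ENNReal.ofReal (Real.exp (γ * r)) * G.measure (ball G.natDist x 1)) := by gcongr
    _ = ENNReal.ofReal (Real.exp (-(2 * α) * (r - 2)) * Real.exp (γ * r)) *
        G.measure (ball G.natDist x 1) := by
      rw [← mul_assoc, ← ENNReal.ofReal_mul (Real.exp_pos _).le, sub_sub, one_add_one_eq_two]
    _ ≤ _ := by
      refine mul_le_mul' (ENNReal.ofReal_le_ofReal hrε) ?_
      exact G.measure_ball_le_normSq_plateau x α hr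

theorem exists_notMem_of_measure_eq_top (hinf : G.measure univ = ∞) (K : Finset X) :
    ∃ x, x ∉ K := by
  by_contra! h
  rw [measure_eq_tsum, tsum_eq_sum (s := K) fun x hx => absurd (h x) hx] at hinf
  refine absurd hinf (ENNReal.sum_ne_top.mpr fun x _ => ?_)
  simp

/-! ### Spectral bounds from volume growth. -/

variable [Countable X]

theorem bottom_le_fujiwaraBound (hconn : G.graph.Connected) (hnorm : ∀ x, G.m x = ∑' y, G.b x y)
    {γ α : ℝ} (hα : 0 < α) (hγα : γ < 2 * α) (hγ : HasGrowthBelow G.measure G.natDist γ) :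
    UnboundedOperator.bottom G.laplacian ≤ (fujiwaraBound ((2 * α : ℝ) : EReal) : EReal) := by
  refine G.bottom_le_of_energy_le hnorm (fujiwaraBound_coe_nonneg _) fun ε hε => ?_
  obtain ⟨r, ⟨⟨x, hfin, hx⟩, hr⟩, hrε⟩ := ((hγ.and_eventually (eventually_ge_atTop 1)).and_eventually
    ((tendsto_exp_sub_zero hγα 2).eventually_le_const hε)).exists
  have hlow := G.measure_ball_le_normSq_plateau x α hr
  refine ⟨G.plateau x α 1 r, fun h0 => G.measure_ball_ne_zero x zero_le_one ?_,
    ne_top_of_le_ne_top ?_ ((G.normSq_plateau_le_measure_ball x hα 1 r).trans hx),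
    G.energy_plateau_one_le hconn hnorm hα hr hε hx hrε⟩
  · rw [h0] at hlow; exact le_antisymm hlow zero_le
  · exact ENNReal.mul_ne_top ENNReal.ofReal_ne_top hfin

/-- The essential bottom when the growth of all balls with some centre is controlled. -/
theorem essentialBottom_le_fujiwaraBound_of_forall (hconn : G.graph.Connected)
    (hnorm : ∀ x, G.m x = ∑' y, G.b x y) (hinf : G.measure univ = ∞) {γ α C : ℝ} (hα : 0 < α)
    (hγα : γ < 2 * α) {x : X} (hx : ∀ r, 0 ≤ r → G.measure (ball G.natDist x r) ≤
      ENNReal.ofReal (C * Real.exp (γ * r))) :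
    UnboundedOperator.essentialBottom G.laplacian ≤
      (fujiwaraBound ((2 * α : ℝ) : EReal) : EReal) := by
  refine G.essentialBottom_le_of_energy_le hnorm (fujiwaraBound_coe_nonneg _) fun ε hε K => ?_
  have hlarge := G.tendsto_measure_ball hinf x
  -- The plateau alone has mass at least `m y / ε` for each `y ∈ K`, while `f y ≤ 1`. Mass at least
  -- `1` makes `f` nonzero and turns an absolute boundary error `ε` into a relative one.
  obtain ⟨k, hk1, hkK⟩ := ((hlarge.eventually_const_le (u := 1) (by simp)).and
    ((eventually_all_finset K).mpr fun y _ => hlarge.eventually_const_le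
      (u := ENNReal.ofReal (G.m y / ε)) (by simp))).exists
  have hlim := (tendsto_exp_sub_zero hγα (1 + k)).const_mul C
  rw [mul_zero] at hlim
  obtain ⟨r, hrε, hrk⟩ := ((hlim.eventually_le_const hε).and
    (eventually_ge_atTop (k : ℝ))).exists
  have hr0 : 0 ≤ r := (Nat.cast_nonneg k).trans hrk
  have hlow := G.measure_ball_le_normSq_plateau x α hrk
  have hone := hk1.trans hlow
  refine ⟨G.plateau x α k r, fun h0 => ?_,
    ne_top_of_le_ne_top ENNReal.ofReal_ne_top
      ((G.normSq_plateau_le_measure_ball x hα k r).trans (hx r hr0)), ?_, fun y hy => ?_⟩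
  · rw [h0] at hone; simp at hone
  · refine (G.energy_plateau_le hconn hnorm x hα k r).trans ?_
    rw [ENNReal.ofReal_add (fujiwaraBound_coe_nonneg _) hε.le, add_mul]
    refine add_le_add le_rfl ?_
    calc _ ≤ ENNReal.ofReal (Real.exp (-(2 * α) * (r - 1 - k))) *
          ENNReal.ofReal (C * Real.exp (γ * r)) := by gcongr; exact hx r hr0
      _ = ENNReal.ofReal (C * (Real.exp (-(2 * α) * (r - (1 + k))) * Real.exp (γ * r))) := by
        rw [← ENNReal.ofReal_mul (Real.exp_pos _).le, sub_sub]
        congr 1; ring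
      _ ≤ ENNReal.ofReal ε * 1 := by rw [mul_one]; gcongr
      _ ≤ _ := by gcongr
  · have h1 := G.plateau_le_one x y hα k r
    have h0 := G.plateau_nonneg x y α k r
    have hm := G.m_pos y
    calc ENNReal.ofReal (G.m y * G.plateau x α k r y ^ 2) ≤ ENNReal.ofReal (ε * (G.m y / ε)) := by
          refine ENNReal.ofReal_le_ofReal ?_
          rw [mul_div_cancel₀ _ hε.ne']
          exact mul_le_of_le_one_right hm.le (pow_le_one₀ h0 h1)
      _ = ENNReal.ofReal ε * ENNReal.ofReal (G.m y / ε) := ENNReal.ofReal_mul hε.le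
      _ ≤ _ := by gcongr; exact (hkK y hy).trans hlow

/-- The essential bottom when no ball growth is controlled at a fixed centre: then test functions
with varying centres lose their mass on finite sets. -/
theorem essentialBottom_le_fujiwaraBound_of_not (hconn : G.graph.Connected)
    (hnorm : ∀ x, G.m x = ∑' y, G.b x y) {γ α : ℝ} (hα : 0 < α) (hγα : γ < 2 * α)
    (hγ : HasGrowthBelow G.measure G.natDist γ)
    (hbig : ∀ C : ℝ, 0 ≤ C → ∀ y, ∃ t, 0 ≤ t ∧
      ENNReal.ofReal (C * Real.exp (2 * α * t)) < G.measure (ball G.natDist y t)) :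
    UnboundedOperator.essentialBottom G.laplacian ≤
      (fujiwaraBound ((2 * α : ℝ) : EReal) : EReal) := by
  refine G.essentialBottom_le_of_energy_le hnorm (fujiwaraBound_coe_nonneg _) fun ε hε K => ?_
  -- These radii depend only on `K` and `ε`, so `r` can be taken large compared with all of them
  -- afterwards.
  choose t ht0 ht using fun y => hbig (G.m y / ε) (div_nonneg (G.m_pos y).le hε.le) y
  obtain ⟨r, ⟨⟨⟨x, hfin, hx⟩, hr⟩, hrε⟩, hrK⟩ :=
    ((((hγ.and_eventually (eventually_ge_atTop 1)).and_eventually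
    ((tendsto_exp_sub_zero hγα 2).eventually_le_const hε))).and_eventually
    ((eventually_all_finset K).mpr fun y _ =>
      (tendsto_exp_sub_zero hγα (t y + 1)).eventually_le_const hε)).exists
  have hlow := G.measure_ball_le_normSq_plateau x α hr
  refine ⟨G.plateau x α 1 r, fun h0 => G.measure_ball_ne_zero x zero_le_one ?_,
    ne_top_of_le_ne_top ?_ ((G.normSq_plateau_le_measure_ball x hα 1 r).trans hx),
    G.energy_plateau_one_le hconn hnorm hα hr hε hx hrε, fun y hy => ?_⟩
  · rw [h0] at hlow; exact le_antisymm hlow zero_le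
  · exact ENNReal.mul_ne_top ENNReal.ofReal_ne_top hfin
  have hm := G.m_pos y
  set f := G.plateau x α 1 r
  have hf0 : 0 ≤ f y := G.plateau_nonneg _ _ _ _ _
  by_cases hyr : y ∈ ball G.natDist x r
  swap
  · rw [show f y = 0 from plateau_of_notMem hyr]; simp
  -- If `B_t(y)` fits into the large ball, `f ≥ e^{-α t} f(y)` there and the large volume of
  -- `B_t(y)` outweighs the mass at `y`. Otherwise `y` is within `t` of the boundary, where the
  -- decay of `f` beats `m y ≤ n(B_r(x)) ≤ e^{γ r} n(B_1(x))`.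
  rcases le_or_gt (G.natDist y x) (r - t y) with hd | hd
  · have hfz : ∀ z ∈ ball G.natDist y (t y), Real.exp (-α * t y) * f y ≤ f z := by
      intro z hz
      have hzd := G.natDist_triangle hconn z y x
      have hz' : G.natDist z y ≤ t y := hz
      have h1 := G.plateau_le_exp_mul hα (ht0 y) (s := 1) (y := y)
        (show z ∈ ball G.natDist x r from show G.natDist z x ≤ r by linarith) (by linarith)
      calc _ ≤ Real.exp (-α * t y) * (Real.exp (α * t y) * f z) := by gcongr
        _ = f z := by rw [← mul_assoc, ← Real.exp_add]; simp
    have h1 := G.mul_measure_le_normSq (by positivity) hfz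
    calc ENNReal.ofReal (G.m y * f y ^ 2)
        = ENNReal.ofReal ε * (ENNReal.ofReal ((Real.exp (-α * t y) * f y) ^ 2) *
          ENNReal.ofReal (G.m y / ε * Real.exp (2 * α * t y))) := by
          rw [← ENNReal.ofReal_mul (by positivity), ← ENNReal.ofReal_mul hε.le]
          congr 1
          have h2 : Real.exp (-α * t y) ^ 2 * Real.exp (2 * α * t y) = 1 := by
            rw [← Real.exp_nat_mul, ← Real.exp_add, Real.exp_eq_one_iff]
            push_cast; ring
          have h3 : ε * (G.m y / ε) = G.m y := mul_div_cancel₀ _ hε.ne'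
          calc G.m y * f y ^ 2 = (ε * (G.m y / ε)) * f y ^ 2 *
                (Real.exp (-α * t y) ^ 2 * Real.exp (2 * α * t y)) := by rw [h2, h3]; ring
            _ = _ := by ring
      _ ≤ _ := by
        gcongr
        refine le_trans ?_ h1
        gcongr
        exact (ht y).le
  · have h1 : f y ≤ Real.exp (-α * (r - (t y + 1))) := G.plateau_le_exp hα (by linarith)
    calc ENNReal.ofReal (G.m y * f y ^ 2)
        ≤ ENNReal.ofReal (Real.exp (-(2 * α) * (r - (t y + 1)))) * ENNReal.ofReal (G.m y) := by
          rw [← ENNReal.ofReal_mul (Real.exp_pos _).le, mul_comm]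
          refine ENNReal.ofReal_le_ofReal ?_
          gcongr
          calc f y ^ 2 ≤ Real.exp (-α * (r - (t y + 1))) ^ 2 := by gcongr
            _ = _ := by rw [← Real.exp_nat_mul]; congr 1; push_cast; ring
      _ ≤ ENNReal.ofReal (Real.exp (-(2 * α) * (r - (t y + 1)))) *
          (ENNReal.ofReal (Real.exp (γ * r)) * G.measure (ball G.natDist x 1)) := by
          gcongr
          exact (G.ofReal_m_le_measure hyr).trans hx
      _ = ENNReal.ofReal (Real.exp (-(2 * α) * (r - (t y + 1))) * Real.exp (γ * r)) *
          G.measure (ball G.natDist x 1) := by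
          rw [← mul_assoc, ← ENNReal.ofReal_mul (Real.exp_pos _).le]
      _ ≤ _ := by
        gcongr
        exact hrK y hy

theorem essentialBottom_le_fujiwaraBound (hconn : G.graph.Connected)
    (hnorm : ∀ x, G.m x = ∑' y, G.b x y) (hinf : G.measure univ = ∞) {γ γ' : ℝ} (hγ0 : 0 < γ)
    (hγγ' : γ < γ') (hγ : HasGrowthBelow G.measure G.natDist γ) :
    UnboundedOperator.essentialBottom G.laplacian ≤ (fujiwaraBound γ' : EReal) := by
  have h2 : γ' = 2 * (γ' / 2) := by ring
  -- Now `2α` is the midpoint of `γ` and `γ'`: the gap above it serves the case of a controlled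
  -- centre, the gap below it the other case.
  set α := (γ + γ') / 4
  have hγα : γ < 2 * α := by simp only [α]; linarith
  have hαγ' : 2 * α < γ' := by simp only [α]; linarith
  by_cases h : ∃ C : ℝ, 0 ≤ C ∧ ∃ y, ∀ r, 0 ≤ r →
      G.measure (ball G.natDist y r) ≤ ENNReal.ofReal (C * Real.exp (2 * α * r))
  · obtain ⟨C, -, y, hy⟩ := h
    rw [h2]
    exact G.essentialBottom_le_fujiwaraBound_of_forall hconn hnorm hinf (by linarith)
      (by linarith) hy
  · push Not at h
    refine (G.essentialBottom_le_fujiwaraBound_of_not hconn hnorm (by linarith) hγα hγ h).trans ?_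
    rw [h2]
    exact EReal.coe_le_coe_iff.mpr (fujiwaraBound_two_mul_mono (by linarith) (by linarith))

theorem bottom_le_one (hnorm : ∀ x, G.m x = ∑' y, G.b x y) (x : X) :
    UnboundedOperator.bottom G.laplacian ≤ 1 := by
  have h := G.bottom_le_of_energy_le hnorm (c := 1) zero_le_one fun ε hε =>
    ⟨({x} : Set X).indicator fun _ => 1, by simp [normSq_indicator, G.m_pos],
      by simp [normSq_indicator], (G.energy_indicator_le hnorm x).trans (by gcongr; linarith)⟩
  simpa using h

/-- Finite sets have finite measure, so there are point functions supported off any given one, with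
Rayleigh quotient at most `1`. This settles infinite growth rates. -/
theorem essentialBottom_le_one (hnorm : ∀ x, G.m x = ∑' y, G.b x y)
    (hinf : G.measure univ = ∞) : UnboundedOperator.essentialBottom G.laplacian ≤ 1 := by
  have h := G.essentialBottom_le_of_energy_le hnorm (c := 1) zero_le_one fun ε hε K => by
    obtain ⟨x, hx⟩ := G.exists_notMem_of_measure_eq_top hinf K
    refine ⟨({x} : Set X).indicator fun _ => 1, by simp [normSq_indicator, G.m_pos],
      by simp [normSq_indicator], (G.energy_indicator_le hnorm x).trans (by gcongr; linarith),
      fun y hy => ?_⟩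
    have : y ≠ x := fun h => hx (h ▸ hy)
    simp [this]
  simpa using h

end WeightedGraph

theorem corollary4 {X : Type*} [Countable X] [MeasurableSpace X] [DiscreteMeasurableSpace X]
    (G : WeightedGraph X) (hconn : G.graph.Connected)
    (hnorm : ∀ x, G.m x = ∑' y, G.b x y) (x₀ : X) :
    -- the bound for the essential spectrum, for graphs of infinite measure
    (G.measure Set.univ = ∞ →
      UnboundedOperator.essentialBottom G.laplacian ≤
        (VolumeGrowth.fujiwaraBound (VolumeGrowth.minExpGrowth G.measure G.natDist) : EReal) ∧
      UnboundedOperator.essentialBottom G.laplacian ≤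
        (VolumeGrowth.fujiwaraBound (VolumeGrowth.expGrowth G.measure G.natDist x₀) : EReal)) ∧
    -- the bound for the whole spectrum
    UnboundedOperator.bottom G.laplacian ≤
        (VolumeGrowth.fujiwaraBound (VolumeGrowth.expGrowth G.measure G.natDist x₀) : EReal) ∧
    UnboundedOperator.bottom G.laplacian ≤
        (VolumeGrowth.fujiwaraBound (VolumeGrowth.minExpGrowth G.measure G.natDist) : EReal) := by
  have hpos : ∀ x, G.measure (VolumeGrowth.ball G.natDist x 1) ≠ 0 := fun x =>
    G.measure_ball_ne_zero x zero_le_one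
  have hbot : ∀ {γ γ' : ℝ}, 0 < γ → γ < γ' →
      VolumeGrowth.HasGrowthBelow G.measure G.natDist γ →
      UnboundedOperator.bottom G.laplacian ≤ (VolumeGrowth.fujiwaraBound γ' : EReal) := by
    intro γ γ' h0 hlt h
    have := G.bottom_le_fujiwaraBound hconn hnorm (α := γ' / 2) (by linarith) (by linarith) h
    rwa [mul_div_cancel₀ _ two_ne_zero] at this
  refine ⟨fun hinf => ⟨?_, ?_⟩, ?_, ?_⟩
  · exact VolumeGrowth.le_fujiwaraBound (G.essentialBottom_le_one hnorm hinf) fun γ γ' ht h0 hlt =>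
      G.essentialBottom_le_fujiwaraBound hconn hnorm hinf h0 hlt
        (VolumeGrowth.hasGrowthBelow_of_minExpGrowth_lt hpos ht)
  · exact VolumeGrowth.le_fujiwaraBound (G.essentialBottom_le_one hnorm hinf) fun γ γ' ht h0 hlt =>
      G.essentialBottom_le_fujiwaraBound hconn hnorm hinf h0 hlt
        (VolumeGrowth.hasGrowthBelow_of_expGrowth_lt (hpos x₀) ht)
  · exact VolumeGrowth.le_fujiwaraBound (G.bottom_le_one hnorm x₀) fun γ γ' ht h0 hlt =>
      hbot h0 hlt (VolumeGrowth.hasGrowthBelow_of_expGrowth_lt (hpos x₀) ht)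
  · exact VolumeGrowth.le_fujiwaraBound (G.bottom_le_one hnorm x₀) fun γ γ' ht h0 hlt =>
      hbot h0 hlt (VolumeGrowth.hasGrowthBelow_of_minExpGrowth_lt hpos ht)
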